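/- Let $V$ and $V_*$ be complex vector spaces with bases $\{v_b\}_{b\in\mathcal B}$ and $\{x_b\}_{b\in\mathcal B}$ indexed by the same set, let ${\bf p}:V\otimes V_*\to\mathbb C$ be the pairing with ${\bf p}(v,w)=\sum_{b} v(b)w(b)$ in these coordinates, and suppose that $\dim V=\aleph_t$ with $t\in\mathbb N=\{0,1,2,\dots\}$. Regard $V_*$ as a subspace of $V^*=\mathrm{Hom}(V,\mathbb C)$ through ${\bf p}$. The Mackey Lie algebra is $$\mathfrak{gl}^M=\{\varphi\in\mathrm{End}(V):\ \varphi^*(V_*)\subset V_*\}.$$ Let $\mathfrak{gl}(V,V_*)=V\otimes V_*\subset\mathfrak{gl}^M$, where $v\otimes w$ acts by $u\mapsto{\bf p}(u,w)v$, and $\mathfrak{sl}(V,V_*)=\ker{\bf p}\subset \mathfrak{gl}(V,V_*)$. For $0\le s\le t+1$ let $V^*_s=\{f\in V^*:\ |\{b\in\mathcal B: f(v_b)\neq0\}|<\aleph_s\}$ and let $\mathfrak{gl}^M_s=\{\varphi\in\mathfrak{gl}^M:\ \varphi^*(V^*)\subset V^*_s\}$; these are ideals of $\mathfrak{gl}^M$,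 with $\mathfrak{gl}^M_0=\mathfrak{gl}(V,V_*)$ and $\mathfrak{gl}^M_{t+1}=\mathfrak{gl}^M$. For a module $M$ over a Lie algebra, $\mathrm{soc}\,M$ is the sum of its simple submodules; $\mathrm{soc}^0M=0$, $\mathrm{soc}^{q}M$ is the preimage in $M$ of $\mathrm{soc}(M/\mathrm{soc}^{q-1}M)$, and $\underline{\mathrm{soc}}^qM=\mathrm{soc}^qM/\mathrm{soc}^{q-1}M$. Further, $\mathrm{rad}\,M$ is the joint kernel of all homomorphisms from $M$ onto simple modules, $\mathrm{rad}^1M=\mathrm{rad}\,M$ and $\mathrm{rad}^{q}M=\mathrm{rad}(\mathrm{rad}^{q-1}M)$. **Theorem.** The adjoint $\mathfrak{gl}^M$-module is indecomposable and has length $t+4$. Its socle filtration is $$\mathrm{soc}^1\mathfrak{gl}^M=\mathbb C\,\mathrm{id}_V\oplus\mathfrak{sl}(V,V_*),\qquad \mathrm{soc}^2\mathfrak{gl}^M=\mathbb C\,\mathrm{id}_V\oplus\mathfrak{gl}(V,V_*),$$ $$\mathrm{soc}^{s+3}\mathfrak{gl}^M=\mathbb C\,\mathrm{id}_V\oplus\mathfrak{gl}^M_{s+1}\quad(0\le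 s\le t-1),\qquad \mathrm{soc}^{t+3}\mathfrak{gl}^M=\mathfrak{gl}^M,$$ with layers, up to the isomorphisms induced by the inclusions, $\underline{\mathrm{soc}}^2\mathfrak{gl}^M\cong\mathfrak{gl}(V,V_*)/\mathfrak{sl}(V,V_*)\cong\mathbb C$ (the one-dimensional trivial module), $\underline{\mathrm{soc}}^{s+3}\mathfrak{gl}^M\cong\mathfrak{gl}^M_{s+1}/\mathfrak{gl}^M_s$ for $0\le s\le t-1$, and $\underline{\mathrm{soc}}^{t+3}\mathfrak{gl}^M=\mathfrak{gl}^M/(\mathbb C\,\mathrm{id}_V\oplus\mathfrak{gl}^M_t)$. The layer $\underline{\mathrm{soc}}^{s+1}\mathfrak{gl}^M$ is a simple $\mathfrak{gl}^M$-module for $1\le s\le t+2$. The radical filtration of the adjoint module is $$\mathrm{rad}^1\mathfrak{gl}^M=\mathbb C\,\mathrm{id}_V\oplus\mathfrak{gl}^M_t,\qquad \mathrm{rad}^{s+1}\mathfrak{gl}^M=\mathfrak{gl}^M_{t-s}\quad(1\le s\le t),\qquad \mathrm{rad}^{t+2}\mathfrak{gl}^M=\mathfrak{sl}(V,V_*).$$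 -/

import Mathlib

open scoped TensorProduct

attribute [local instance 100] LieRing.ofAssociativeRing

/-! ## General notions for modules over a Lie algebra -/

namespace LieRep

section

variable (R L M : Type*) [CommRing R] [LieRing L] [LieAlgebra R L]
  [AddCommGroup M] [Module R M] [LieRingModule L M] [LieModule R L M]

/-- A Lie module is indecomposable if it is nonzero and is not the direct sum of two nonzero
submodules. -/
def IsIndecomposable : Prop :=
  Nontrivial M ∧ ∀ A B : LieSubmodule R L M, IsCompl A B → A = ⊥ ∨ B = ⊥

/-- The length of a Lie module: the Krull dimension of its lattice of submodules, i.e. the supremum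
of the lengths of strict chains of submodules (compare `Module.length`). -/
noncomputable def length : WithBot ℕ∞ :=
  Order.krullDim (LieSubmodule R L M)

/-- The socle: the sum of all simple submodules. -/
def socle : LieSubmodule R L M :=
  sSup {N : LieSubmodule R L M | LieModule.IsIrreducible R L N}

/-- The radical: the intersection of all submodules with simple quotient, i.e. of the kernels of all
homomorphisms onto simple quotients. -/
def radical : LieSubmodule R L M :=
  sInf {N : LieSubmodule R L M | LieModule.IsIrreducible R L (M ⧸ N)}

/-- The socle filtration: `soc⁰ M = 0`, and `soc^(q+1) M` is the preimage of the socle of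
`M / soc^q M`. -/
def soc : ℕ → LieSubmodule R L M
  | 0 => ⊥
  | q + 1 => (socle R L (M ⧸ soc q)).comap (LieSubmodule.Quotient.mk' (soc q))

/-- The radical filtration: `rad⁰ M = M` and `rad^(q+1) M = rad (rad^q M)`. -/
def rad : ℕ → LieSubmodule R L M
  | 0 => ⊤
  | q + 1 => (radical R L (rad q)).map (rad q).incl

end

section

variable {R L M : Type*} [CommRing R] [LieRing L] [LieAlgebra R L]
  [AddCommGroup M] [Module R M] [LieRingModule L M] [LieModule R L M]

/-- `N` is the (internal) direct sum of the submodules `A` and `B`. -/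
def IsDirectSum (N A B : LieSubmodule R L M) : Prop :=
  A ⊔ B = N ∧ Disjoint A B

/-- The quotient `N / (N ∩ P)` of submodules of `M`; it is `N / P` if `P ≤ N`. -/
abbrev Subquotient (N P : LieSubmodule R L M) : Type _ :=
  N ⧸ P.comap N.incl

/-- The identity of `M` induces an isomorphism from `N / P` to `N' / P'`: there is an isomorphism
under which the class of `x` corresponds to the class of `x`, for every `x` in `N ∩ N'`, and `N` is
contained in `N'`. -/
def CanonicallyIso (N P N' P' : LieSubmodule R L M) : Prop :=
  ∃ (h : N ≤ N') (e : Subquotient N P ≃ₗ⁅R,L⁆ Subquotient N' P'), ∀ x : N,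
    e (LieSubmodule.Quotient.mk x) = LieSubmodule.Quotient.mk (⟨x, h x.2⟩ : N')

end

section

variable (R L M : Type*) [CommRing R] [LieRing L] [LieAlgebra R L]
  [AddCommGroup M] [Module R M] [LieRingModule L M] [LieModule R L M]

/-- The layer `soc^q M / soc^(q-1) M` of the socle filtration, for `q ≥ 1`. -/
abbrev Layer (q : ℕ) : Type _ :=
  Subquotient (soc R L M q) (soc R L M (q - 1))

end

end LieRep

/-! ## Mackey Lie algebras -/

/-- A diagonalized pairing of complex vector spaces `V` and `W`: a bilinear form together with bases
of `V` and `W`, indexed by the same set, in which it is `∑ b, v(b) w(b)`. The space `W` is then the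
restricted dual of `V`. -/
structure DiagonalPairing (B V W : Type*) [AddCommGroup V] [Module ℂ V]
    [AddCommGroup W] [Module ℂ W] where
  form : V →ₗ[ℂ] W →ₗ[ℂ] ℂ
  basisV : Module.Basis B ℂ V
  basisW : Module.Basis B ℂ W
  form_eq : ∀ (v : V) (w : W),
    form v w = (basisV.repr v).sum fun b c => c * basisW.repr w b

namespace Mackey

section

variable {V W : Type*} [AddCommGroup V] [Module ℂ V] [AddCommGroup W] [Module ℂ W]

/-- The Mackey Lie algebra `{φ ∈ gl(V) : φ^*(W) ⊆ W}` of a bilinear form, where `W` stands for its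
image in the dual space of `V`. -/
def glM (p : V →ₗ[ℂ] W →ₗ[ℂ] ℂ) : LieSubalgebra ℂ (Module.End ℂ V) where
  carrier := {φ | (LinearMap.range p.flip).map φ.dualMap ≤ LinearMap.range p.flip}
  zero_mem' := by
    rintro _ ⟨f, -, rfl⟩
    have h : (0 : Module.End ℂ V).dualMap f = 0 := by ext; simp
    rw [h]; exact Submodule.zero_mem _
  add_mem' := by
    rintro φ ψ hφ hψ _ ⟨f, hf, rfl⟩
    have h : (φ + ψ).dualMap f = φ.dualMap f + ψ.dualMap f := by ext; simp
    rw [h]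
    exact Submodule.add_mem _ (hφ ⟨f, hf, rfl⟩) (hψ ⟨f, hf, rfl⟩)
  smul_mem' := by
    rintro c φ hφ _ ⟨f, hf, rfl⟩
    have h : (c • φ).dualMap f = c • φ.dualMap f := by ext; simp
    rw [h]
    exact Submodule.smul_mem _ _ (hφ ⟨f, hf, rfl⟩)
  lie_mem' := by
    rintro φ ψ hφ hψ _ ⟨f, hf, rfl⟩
    have h : (⁅φ, ψ⁆ : Module.End ℂ V).dualMap f =
        ψ.dualMap (φ.dualMap f) - φ.dualMap (ψ.dualMap f) := by
      ext; simp [Ring.lie_def]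
    rw [h]
    exact Submodule.sub_mem _ (hψ ⟨_, hφ ⟨f, hf, rfl⟩, rfl⟩) (hφ ⟨_, hψ ⟨f, hf, rfl⟩, rfl⟩)

theorem exists_adjoint {p : V →ₗ[ℂ] W →ₗ[ℂ] ℂ} (y : glM p) (w : W) :
    ∃ w' : W, ∀ v : V, p ((y : Module.End ℂ V) v) w = p v w' := by
  obtain ⟨w', hw'⟩ := y.2 ⟨p.flip w, ⟨w, rfl⟩, rfl⟩
  exact ⟨w', fun v => (LinearMap.congr_fun hw' v).symm⟩

/-- The ideal of scalar operators `ℂ id_V`. -/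
def scalars (p : V →ₗ[ℂ] W →ₗ[ℂ] ℂ) : LieIdeal ℂ (glM p) where
  carrier := {x | ∃ c : ℂ, (x : Module.End ℂ V) = c • LinearMap.id}
  zero_mem' := ⟨0, by simp⟩
  add_mem' := by
    rintro x y ⟨c, hc⟩ ⟨d, hd⟩
    exact ⟨c + d, by simp [hc, hd, add_smul]⟩
  smul_mem' := by
    rintro a x ⟨c, hc⟩
    exact ⟨a * c, by simp [hc, mul_smul]⟩
  lie_mem := by
    rintro y x ⟨c, hc⟩
    refine ⟨0, ?_⟩
    ext u
    simp [hc, Ring.lie_def]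

/-- The linear map `V ⊗ W → End V` sending `v ⊗ w` to the operator `u ↦ p(u, w) v`. -/
noncomputable def tensorToEnd (p : V →ₗ[ℂ] W →ₗ[ℂ] ℂ) : V ⊗[ℂ] W →ₗ[ℂ] Module.End ℂ V :=
  TensorProduct.lift
    (LinearMap.mk₂ ℂ (fun v w => (p.flip w).smulRight v)
      (by intros; ext; simp) (by intro c v w; ext u; simp [smul_smul, mul_comm])
      (by intros; ext; simp [add_smul]) (by intros; ext; simp [mul_smul]))

theorem exists_lie_tensorToEnd {p : V →ₗ[ℂ] W →ₗ[ℂ] ℂ} (y : glM p) (z : V ⊗[ℂ] W) :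
    ∃ z' : V ⊗[ℂ] W, TensorProduct.lift p z' = 0 ∧
      tensorToEnd p z' = ⁅(y : Module.End ℂ V), tensorToEnd p z⁆ := by
  induction z with
  | zero => exact ⟨0, by simp, by simp⟩
  | add a b ha hb =>
    obtain ⟨a', ha, ha'⟩ := ha
    obtain ⟨b', hb, hb'⟩ := hb
    exact ⟨a' + b', by simp [ha, hb], by simp [ha', hb']⟩
  | tmul v w =>
    obtain ⟨w', hw'⟩ := exists_adjoint y w
    refine ⟨(y : Module.End ℂ V) v ⊗ₜ w - v ⊗ₜ w', by simp [hw'], ?_⟩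
    ext u
    simp [tensorToEnd, Ring.lie_def, hw']

/-- The ideal `gl(V, W)`: the image of `V ⊗ W` in `End V`. -/
noncomputable def glFin (p : V →ₗ[ℂ] W →ₗ[ℂ] ℂ) : LieIdeal ℂ (glM p) where
  __ := (LinearMap.range (tensorToEnd p)).comap (glM p).toSubmodule.subtype
  lie_mem := by
    rintro y x ⟨z, hz⟩
    obtain ⟨z', -, hz'⟩ := exists_lie_tensorToEnd y z
    exact ⟨z', by rw [hz', hz]; rfl⟩

/-- The ideal `sl(V, W)`: the image in `End V` of the kernel of `p : V ⊗ W → ℂ`. -/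
noncomputable def slFin (p : V →ₗ[ℂ] W →ₗ[ℂ] ℂ) : LieIdeal ℂ (glM p) where
  __ := ((LinearMap.ker (TensorProduct.lift p)).map (tensorToEnd p)).comap
    (glM p).toSubmodule.subtype
  lie_mem := by
    rintro y x ⟨z, -, hz⟩
    obtain ⟨z', h0, hz'⟩ := exists_lie_tensorToEnd y z
    exact ⟨z', h0, by rw [hz', hz]; rfl⟩

end

section

universe u

variable {B : Type u} {V W : Type*} [AddCommGroup V] [Module ℂ V] [AddCommGroup W] [Module ℂ W]

/-- The subspace `V^*_s` of the dual space of `V`: the functionals that are nonzero on fewer than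
`ℵ_s` vectors of the given basis of `V`. -/
def dualFilt (P : DiagonalPairing B V W) (s : ℕ) : Submodule ℂ (Module.Dual ℂ V) where
  carrier := {f | Cardinal.mk {b : B | f (P.basisV b) ≠ 0} < Cardinal.aleph (s : Ordinal.{u})}
  zero_mem' := by
    simpa using Cardinal.aleph0_pos.trans_le (Cardinal.aleph0_le_aleph _)
  add_mem' := by
    intro f g hf hg
    refine (Cardinal.mk_le_mk_of_subset (t := {b : B | f (P.basisV b) ≠ 0} ∪
      {b : B | g (P.basisV b) ≠ 0}) ?_).trans_lt ((Cardinal.mk_union_le _ _).trans_lt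
      (Cardinal.add_lt_of_lt (Cardinal.aleph0_le_aleph _) hf hg))
    intro b hb
    by_contra h
    simp only [Set.mem_union, Set.mem_ofPred_eq, not_or, not_not] at h
    exact hb (by simp [h.1, h.2])
  smul_mem' := by
    intro c f hf
    refine (Cardinal.mk_le_mk_of_subset ?_).trans_lt hf
    intro b hb h
    exact hb (by simp [h])

theorem form_basis (P : DiagonalPairing B V W) (v : V) (b : B) :
    P.form v (P.basisW b) = P.basisV.repr v b := by
  classical
  rw [P.form_eq, Finsupp.sum]
  simp only [Module.Basis.repr_self, Finsupp.single_apply, mul_ite, mul_one, mul_zero]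
  rw [Finset.sum_ite_eq]
  split_ifs with h
  · rfl
  · exact (Finsupp.notMem_support_iff.1 h).symm

theorem basis_form (P : DiagonalPairing B V W) (a : B) (w : W) :
    P.form (P.basisV a) w = P.basisW.repr w a := by
  rw [P.form_eq]
  simp

theorem dualMap_mem_dualFilt (P : DiagonalPairing B V W) (s : ℕ) (y : glM P.form)
    (f : Module.Dual ℂ V) (hf : f ∈ dualFilt P s) :
    (y : Module.End ℂ V).dualMap f ∈ dualFilt P s := by
  classical
  choose w' hw' using fun b => exists_adjoint y (P.basisW b)
  set S : Set B := {b : B | f (P.basisV b) ≠ 0} with hS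
  have hsub : {a : B | (y : Module.End ℂ V).dualMap f (P.basisV a) ≠ 0} ⊆
      ⋃ b : S, ((P.basisW.repr (w' b)).support : Set B) := by
    intro a ha
    by_contra hcon
    simp only [Set.mem_iUnion, Finset.mem_coe, Finsupp.mem_support_iff, not_exists, not_not,
      Subtype.forall] at hcon
    apply ha
    rw [LinearMap.dualMap_apply, ← P.basisV.linearCombination_repr ((y : Module.End ℂ V) _),
      Finsupp.linearCombination_apply, map_finsuppSum]
    refine Finset.sum_eq_zero fun b _ => ?_
    by_cases hb : f (P.basisV b) = 0
    · simp [hb]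
    · have h := hcon b hb
      rw [← basis_form, ← hw', form_basis] at h
      simp [h]
  have hS' : Cardinal.mk S < Cardinal.aleph (s : Ordinal.{u}) := hf
  change Cardinal.mk {a : B | _} < _
  refine (Cardinal.mk_le_mk_of_subset hsub).trans_lt ?_
  rcases S.finite_or_infinite with hfin | hinf
  · have := hfin.to_subtype
    refine lt_of_lt_of_le ?_ (Cardinal.aleph0_le_aleph _)
    rw [Cardinal.lt_aleph0_iff_set_finite]
    exact Set.finite_iUnion fun b => Finset.finite_toSet _
  · have := hinf.to_subtype
    refine lt_of_le_of_lt ?_ hS'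
    refine (Cardinal.mk_iUnion_le _).trans ?_
    refine (mul_le_mul_right (ciSup_le' fun b => ?_) _).trans
      (Cardinal.mul_eq_left (Cardinal.aleph0_le_mk S) (Cardinal.aleph0_le_mk S)
        Cardinal.aleph0_ne_zero).le
    · exact Cardinal.mk_le_aleph0

/-- The ideal `gl^M_s = {φ ∈ gl^M : φ^*(V^*) ⊆ V^*_s}`. -/
def glMs (P : DiagonalPairing B V W) (s : ℕ) : LieIdeal ℂ (glM P.form) where
  carrier := {x | ∀ f : Module.Dual ℂ V, (x : Module.End ℂ V).dualMap f ∈ dualFilt P s}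
  zero_mem' := by
    intro f
    have h : ((0 : glM P.form) : Module.End ℂ V).dualMap f = 0 := by ext; simp
    rw [h]; exact Submodule.zero_mem _
  add_mem' := by
    intro x y hx hy f
    have h : ((x + y : glM P.form) : Module.End ℂ V).dualMap f =
        (x : Module.End ℂ V).dualMap f + (y : Module.End ℂ V).dualMap f := by ext; simp
    rw [h]; exact Submodule.add_mem _ (hx f) (hy f)
  smul_mem' := by
    intro c x hx f
    have h : ((c • x : glM P.form) : Module.End ℂ V).dualMap f =
        c • (x : Module.End ℂ V).dualMap f := by ext; simp
    rw [h]; exact Submodule.smul_mem _ _ (hx f)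
  lie_mem := by
    intro y x hx f
    have h : ((⁅y, x⁆ : glM P.form) : Module.End ℂ V).dualMap f =
        (x : Module.End ℂ V).dualMap ((y : Module.End ℂ V).dualMap f) -
          (y : Module.End ℂ V).dualMap ((x : Module.End ℂ V).dualMap f) := by
      ext; simp [Ring.lie_def]
    rw [h]
    exact Submodule.sub_mem _ (hx _) (dualMap_mem_dualFilt P s y _ (hx f))

end

end Mackey

/-! Submodules of the adjoint module are ideals, so the theorem concerns the lattice of ideals of
`gl^M`. Write `C = ℂ id`, `S = sl` and `G s = gl^M_s`. In the given basis, `gl^M` consists of the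
matrices with finite rows and columns, and `G s` of those with fewer than `ℵ_s` nonzero columns
(`mem_glMs_iff`). Two facts control the lattice: an ideal not inside `C` contains `S` (`slFin_le`),
and an ideal not inside `C ⊔ G s` contains `G (s + 1)` (`glMs_succ_le`). Together with some
elementary relations they form `IdealChain`, from which the length, indecomposability and both
filtrations follow by modular lattice theory.

For the second fact, let `I` contain an operator that differs from every scalar on at least `κ =
ℵ_s` columns. A commutator with a partial permutation produces `κ` columns with off-diagonal
entries. As rows and columns are finite, `κ` of these entries can be chosen independent of each
other, and they yield a full off-diagonal block of size `κ` in `I`. Whenever one of the products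
`xy`, `yx` vanishes, the commutator is a one-sided product up to sign, so partial isomorphisms carry
this block to every off-diagonal position. Diagonal blocks come from a swindle: an operator `w` on a
block with infinitely many disjoint copies is the commutator of a shift of the copies and an
operator with only off-diagonal blocks.

The first fact is the same argument with one matrix entry, giving all `E_ab` with `a ≠ b`, hence all
differences `E_aa - E_bb`. -/

/-! ## Lattices of Lie submodules -/

/-- A finite maximal chain in a modular lattice computes its Krull dimension. -/
theorem krullDim_eq_of_covBy_chain {α : Type*} [Lattice α] [IsModularLattice α] [BoundedOrder α]
    (c : ℕ → α) (n : ℕ) (h0 : c 0 = ⊥) (hn : c n = ⊤) (hc : ∀ i < n, c i ⋖ c (i + 1)) :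
    Order.krullDim α = n := by
  classical
  -- Each covering step is either fully gained by `x` or not at all; `I x` below records the steps
  -- gained. If `I` is strictly monotone, a strict chain has length at most `n`.
  have hdich : ∀ i < n, ∀ x, ¬ c (i + 1) ≤ c i ⊔ x → (c i ⊔ x) ⊓ c (i + 1) = c i := by
    intro i hi x hx
    refine ((hc i hi).eq_or_eq (le_inf le_sup_left (hc i hi).le) inf_le_right).resolve_right ?_
    intro h
    exact hx (inf_eq_right.1 h)
  let I : α → Finset ℕ := fun x => (Finset.range n).filter fun i => c (i + 1) ≤ c i ⊔ x
  have hmono : ∀ x y, x < y → I x ⊂ I y := by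
    intro x y hxy
    have hsub : I x ⊆ I y := Finset.monotone_filter_right _
      fun i _ h => le_trans h (sup_le_sup_left hxy.le _)
    refine hsub.ssubset_of_ne fun hI => hxy.ne ?_
    -- Comparable elements with the same steps have the same trace on each `c i`, by modular
    -- cancellation against `c i`; at `i = n` they coincide.
    have key : ∀ i ≤ n, x ⊓ c i = y ⊓ c i := by
      intro i
      induction i with
      | zero => simp [h0]
      | succ i ih =>
        intro hi
        have hi' : i < n := hi
        have hle := (hc i hi').le
        have hs : (c i ⊔ x) ⊓ c (i + 1) = (c i ⊔ y) ⊓ c (i + 1) := by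
          have hiff : c (i + 1) ≤ c i ⊔ x ↔ c (i + 1) ≤ c i ⊔ y := by
            simpa [I, hi'] using Finset.ext_iff.1 hI i
          by_cases h : c (i + 1) ≤ c i ⊔ x
          · rw [inf_eq_right.2 h, inf_eq_right.2 (hiff.1 h)]
          · rw [hdich i hi' x h, hdich i hi' y (mt hiff.2 h)]
        rw [sup_inf_assoc_of_le _ hle, sup_inf_assoc_of_le _ hle] at hs
        refine eq_of_le_of_inf_le_of_sup_le (z := c i) (inf_le_inf_right _ hxy.le) ?_ ?_
        · rw [inf_assoc, inf_assoc, inf_eq_right.2 hle, ih hi'.le]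
        · rw [sup_comm, sup_comm _ (c i), hs]
    simpa [hn] using key n le_rfl
  apply le_antisymm
  · let f : α → Fin (n + 1) := fun x => ⟨(I x).card, Nat.lt_succ_of_le
      ((Finset.card_filter_le _ _).trans (Finset.card_range n).le)⟩
    have hf : StrictMono f := fun x y h => Finset.card_lt_card (hmono x y h)
    refine iSup_le fun p => WithBot.coe_le_coe.2 (Nat.cast_le.2 ?_)
    simpa [Nat.lt_succ_iff] using (p.map f hf).length_lt_card
  · let s : LTSeries α := ⟨n, fun i => c i, fun i => by simpa using (hc i i.2).lt⟩
    exact Order.LTSeries.length_le_krullDim s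

namespace LieRep

variable {R L M : Type*} [CommRing R] [LieRing L] [LieAlgebra R L]
  [AddCommGroup M] [Module R M] [LieRingModule L M] [LieModule R L M]

/-- Submodules of a quotient correspond to submodules containing the kernel. -/
def quotientOrderIso (N : LieSubmodule R L M) : LieSubmodule R L (M ⧸ N) ≃o Set.Ici N where
  toFun K := ⟨K.comap (LieSubmodule.Quotient.mk' N), fun x hx => by
    rw [LieSubmodule.mem_comap, (LieSubmodule.Quotient.mk_eq_zero _).2 hx]; exact zero_mem _⟩
  invFun K := K.1.map (LieSubmodule.Quotient.mk' N)
  left_inv K := by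
    ext x
    obtain ⟨y, rfl⟩ := LieSubmodule.Quotient.surjective_mk' N x
    simp only [LieSubmodule.mem_map, LieSubmodule.mem_comap]
    exact ⟨fun ⟨z, hz, h⟩ => h ▸ hz, fun h => ⟨y, h, rfl⟩⟩
  right_inv K := by
    ext x
    simp only [LieSubmodule.mem_map, LieSubmodule.mem_comap]
    refine ⟨fun ⟨z, hz, h⟩ => ?_, fun h => ⟨x, h, rfl⟩⟩
    have hx : x - z ∈ N := by
      rw [← LieSubmodule.Quotient.mk_eq_zero, map_sub, h, sub_self]
    simpa using add_mem (K.2 hx) hz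
  map_rel_iff' {K K'} := by
    refine ⟨fun h x hx => ?_, fun h x hx => h hx⟩
    obtain ⟨y, rfl⟩ := LieSubmodule.Quotient.surjective_mk' N x
    exact h hx

/-- Submodules of a submodule `N` correspond to submodules contained in `N`. -/
def subOrderIso (N : LieSubmodule R L M) : LieSubmodule R L N ≃o Set.Iic N where
  toFun K := ⟨K.map N.incl, LieSubmodule.map_incl_le⟩
  invFun K := K.1.comap N.incl
  left_inv K := by ext x; simp
  right_inv K := by
    ext x
    simpa using fun h => K.2 h
  map_rel_iff' {K K'} := LieSubmodule.map_le_map_iff (N.injective_incl)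

theorem isIrreducible_quotient_iff {N : LieSubmodule R L M} :
    LieModule.IsIrreducible R L (M ⧸ N) ↔ IsCoatom N :=
  (quotientOrderIso N).isSimpleOrder_iff.trans Set.isSimpleOrder_Ici_iff_isCoatom

theorem isIrreducible_subquotient {N P : LieSubmodule R L M} (h : P ⋖ N) :
    LieModule.IsIrreducible R L (Subquotient N P) := by
  rw [isIrreducible_quotient_iff, ← (subOrderIso N).isCoatom_iff, Set.Iic.isCoatom_iff]
  have hP : ((subOrderIso N) (P.comap N.incl) : LieSubmodule R L M) = P :=
    congrArg Subtype.val ((subOrderIso N).apply_symm_apply ⟨P, h.le⟩)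
  rwa [hP]

/-- Simple submodules of `M / soc^q M` correspond to covers of `soc^q M`, so the filtration can be
computed in the lattice. The join with `soc R L M q` matters when there are no covers, as `sSup ∅ =
⊥`. -/
theorem soc_succ (q : ℕ) :
    soc R L M (q + 1) = soc R L M q ⊔ sSup {E | soc R L M q ⋖ E} := by
  set D := soc R L M q
  set e := quotientOrderIso D
  have hatom : ∀ K : LieSubmodule R L (M ⧸ D),
      LieModule.IsIrreducible R L K ↔ D ⋖ (e K : LieSubmodule R L M) := fun K => by
    refine ((subOrderIso K).isSimpleOrder_iff.trans Set.isSimpleOrder_Iic_iff_isAtom).trans ?_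
    rw [← e.isAtom_iff, Set.Ici.isAtom_iff]
  change ((e (socle R L (M ⧸ D)) : Set.Ici D) : LieSubmodule R L M) = _
  apply le_antisymm
  · let Z : Set.Ici D := ⟨D ⊔ sSup {E | D ⋖ E}, Set.mem_Ici.2 le_sup_left⟩
    change e (socle R L (M ⧸ D)) ≤ Z
    rw [← e.le_symm_apply]
    refine sSup_le fun K hK => ?_
    rw [e.le_symm_apply]
    change (e K).1 ≤ D ⊔ sSup {E | D ⋖ E}
    exact le_sup_of_le_right (le_sSup ((hatom K).1 hK))
  · refine sup_le (e _).2 (sSup_le fun E hE => ?_)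
    let E' : Set.Ici D := ⟨E, hE.le⟩
    change E' ≤ e (socle R L (M ⧸ D))
    rw [← e.symm_apply_le]
    refine le_sSup ((hatom _).2 ?_)
    rw [e.apply_symm_apply]
    exact hE

/-- Dual to `soc_succ`; the meet with `rad R L M q` covers the case `sInf ∅ = ⊤`. -/
theorem rad_succ (q : ℕ) :
    rad R L M (q + 1) = rad R L M q ⊓ sInf {F | F ⋖ rad R L M q} := by
  set N := rad R L M q
  set e := subOrderIso N
  have hcoatom : ∀ K : LieSubmodule R L N,
      LieModule.IsIrreducible R L (N ⧸ K) ↔ (e K : LieSubmodule R L M) ⋖ N := fun K => by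
    rw [isIrreducible_quotient_iff, ← e.isCoatom_iff, Set.Iic.isCoatom_iff]
  change ((e (radical R L N) : Set.Iic N) : LieSubmodule R L M) = _
  apply le_antisymm
  · refine le_inf (e _).2 (le_sInf fun F hF => ?_)
    let F' : Set.Iic N := ⟨F, hF.le⟩
    change e (radical R L N) ≤ F'
    rw [← e.le_symm_apply]
    refine sInf_le ((hcoatom _).2 ?_)
    rw [e.apply_symm_apply]
    exact hF
  · let Z : Set.Iic N := ⟨N ⊓ sInf {F | F ⋖ N}, Set.mem_Iic.2 inf_le_left⟩
    change Z ≤ e (radical R L N)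
    rw [← e.symm_apply_le]
    refine le_sInf fun K hK => ?_
    rw [e.symm_apply_le]
    change N ⊓ sInf {F | F ⋖ N} ≤ (e K).1
    exact inf_le_of_right_le (sInf_le ((hcoatom K).1 hK))

/-- Second isomorphism theorem. -/
theorem canonicallyIso_of_sup_eq {N P N' P' : LieSubmodule R L M} (hP : P ≤ P')
    (hsup : P' ⊔ N = N') (hinf : P' ⊓ N ≤ P) : CanonicallyIso N P N' P' := by
  have h : N ≤ N' := hsup ▸ le_sup_right
  let f : Subquotient N P →ₗ[R] Subquotient N' P' :=
    Submodule.mapQ (P.comap N.incl).toSubmodule (P'.comap N'.incl).toSubmodule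
      (LieSubmodule.inclusion h : N →ₗ[R] N') fun x hx => hP hx
  have hf : ∀ x : N, f (LieSubmodule.Quotient.mk x) =
      LieSubmodule.Quotient.mk (⟨x, h x.2⟩ : N') := fun x => rfl
  have hbij : Function.Bijective f := by
    constructor
    · rw [injective_iff_map_eq_zero]
      intro x hx
      obtain ⟨y, rfl⟩ := LieSubmodule.Quotient.surjective_mk' _ x
      have hy : (⟨y, h y.2⟩ : N') ∈ P'.comap N'.incl := by
        rw [← LieSubmodule.Quotient.mk_eq_zero]; exact hx
      exact (LieSubmodule.Quotient.mk_eq_zero _).2 (hinf ⟨hy, y.2⟩)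
    · intro x
      obtain ⟨⟨y, hy⟩, rfl⟩ := LieSubmodule.Quotient.surjective_mk' _ x
      rw [← hsup] at hy
      obtain ⟨a, ha, b, hb, rfl⟩ := (LieSubmodule.mem_sup _ _ _).1 hy
      refine ⟨LieSubmodule.Quotient.mk (⟨b, hb⟩ : N), ?_⟩
      rw [hf]
      symm
      refine (Submodule.Quotient.eq (P'.comap N'.incl).toSubmodule).2 ?_
      change a + b - b ∈ P'
      simpa using ha
  let e := LinearEquiv.ofBijective f hbij
  refine ⟨h, { e with map_lie' := ?_ }, hf⟩
  intro x m
  obtain ⟨y, rfl⟩ := LieSubmodule.Quotient.surjective_mk' _ m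
  rfl

end LieRep

/-! ## The lattice of ideals -/

/-- The properties of the ideals `C = ℂ id`, `S = sl` and `G s = gl^M_s` in the lattice of ideals
that determine the socle and the radical filtration. -/
structure IdealChain {α : Type*} [CompleteLattice α] (t : ℕ) (C S : α) (G : ℕ → α) : Prop where
  atom : IsAtom C
  ne_bot : S ≠ ⊥
  mono : Monotone G
  eq_top : G (t + 1) = ⊤
  inf_eq : C ⊓ G t = ⊥
  covBy : S ⋖ G 0
  le_of_not_le : ∀ I, ¬ I ≤ C → S ≤ I
  succ_le_of_not_le : ∀ s ≤ t, ∀ I, ¬ I ≤ C ⊔ G s → G (s + 1) ≤ I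
  not_succ_le : ∀ s ≤ t, ¬ G (s + 1) ≤ C ⊔ G s

namespace IdealChain

variable {α : Type*} [CompleteLattice α] {t : ℕ} {C S : α} {G : ℕ → α}

theorem disjoint (h : IdealChain t C S G) {s : ℕ} (hs : s ≤ t) : C ⊓ G s = ⊥ :=
  le_bot_iff.1 ((inf_le_inf_left _ (h.mono hs)).trans h.inf_eq.le)

theorem disjoint_bot (h : IdealChain t C S G) : C ⊓ S = ⊥ :=
  le_bot_iff.1 ((inf_le_inf_left _ h.covBy.le).trans (h.disjoint (Nat.zero_le _)).le)

theorem isAtom_bot (h : IdealChain t C S G) : IsAtom S := by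
  refine ⟨h.ne_bot, fun I hI => ?_⟩
  by_contra hne
  refine hI.not_ge (h.le_of_not_le I fun hC => hne ?_)
  exact le_bot_iff.1 ((le_inf hC hI.le).trans h.disjoint_bot.le)

theorem sup_covBy_sup_succ (h : IdealChain t C S G) {s : ℕ} (hs : s ≤ t) :
    C ⊔ G s ⋖ C ⊔ G (s + 1) := by
  refine ⟨lt_of_le_of_ne (sup_le_sup_left (h.mono (Nat.le_succ s)) _) fun he =>
    h.not_succ_le s hs (he ▸ le_sup_right), fun I h1 h2 => h2.not_ge ?_⟩
  exact sup_le (le_sup_left.trans h1.le) (h.succ_le_of_not_le s hs I h1.not_ge)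

theorem le_or_eq_top (h : IdealChain t C S G) (I : α) : I ≤ C ⊔ G t ∨ I = ⊤ := by
  by_cases hI : I ≤ C ⊔ G t
  · exact Or.inl hI
  · exact Or.inr (top_le_iff.1 (h.eq_top ▸ h.succ_le_of_not_le t le_rfl I hI))

theorem sup_covBy_top (h : IdealChain t C S G) : C ⊔ G t ⋖ ⊤ := by
  simpa [h.eq_top] using h.sup_covBy_sup_succ (le_refl t)

/-- Every proper element lies below the single coatom `C ⊔ G t`, so two proper elements never join
to `⊤`. -/
theorem indecomposable (h : IdealChain t C S G) (A B : α) (hAB : IsCompl A B) :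
    A = ⊥ ∨ B = ⊥ := by
  rcases h.le_or_eq_top A with hA | rfl
  · rcases h.le_or_eq_top B with hB | rfl
    · exact absurd (hAB.sup_eq_top ▸ sup_le hA hB) h.sup_covBy_top.lt.not_ge
    · exact Or.inl (by simpa using hAB.inf_eq_bot)
  · exact Or.inr (by simpa using hAB.inf_eq_bot)

/-- Under `hle`, `E` is the only cover of `D`. This makes every socle layer after the first simple.
-/
theorem sup_sSup_covBy {D E : α} (hDE : D ⋖ E) (hle : ∀ I, D < I → E ≤ I) :
    D ⊔ sSup {F | D ⋖ F} = E := by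
  apply le_antisymm
  · refine sup_le hDE.le (sSup_le fun F hF => ?_)
    rcases (hF : D ⋖ F).eq_or_eq hDE.le (hle F hF.lt) with h | h
    · exact absurd h hDE.lt.ne'
    · exact h.ge
  · exact le_sup_of_le_right (le_sSup hDE)

section

variable [IsModularLattice α]

/-- The modular law cancels `C`, which meets `G s` trivially. -/
theorem sup_inf (h : IdealChain t C S G) {s : ℕ} (hs : s ≤ t) {X : α} (hX : X ≤ G s) :
    (C ⊔ X) ⊓ G s = X := by
  rw [sup_comm, sup_inf_assoc_of_le _ hX, h.disjoint hs, sup_bot_eq]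

/-- The cover `C ⊔ G s ⋖ C ⊔ G (s + 1)` is intersected with `G (s + 1)`. The case `s = t` fails: `C
⊔ G t` lies strictly between `G t` and `⊤`. -/
theorem covBy_succ (h : IdealChain t C S G) {s : ℕ} (hs : s < t) : G s ⋖ G (s + 1) := by
  have h1 : C ⊔ G s ⋖ (C ⊔ G s) ⊔ G (s + 1) := by
    rw [sup_assoc, sup_eq_right.2 (h.mono (Nat.le_succ s))]
    exact h.sup_covBy_sup_succ hs.le
  have h2 := inf_covBy_of_covBy_sup_left h1
  rwa [h.sup_inf hs (h.mono (Nat.le_succ s))] at h2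

theorem covBy_sup (h : IdealChain t C S G) : G t ⋖ C ⊔ G t := by
  refine covBy_sup_of_inf_covBy_left ?_
  rw [h.inf_eq]
  exact bot_covBy_iff.2 h.atom

theorem sup_covBy_sup (h : IdealChain t C S G) : C ⊔ S ⋖ C ⊔ G 0 := by
  have h1 : G 0 ⊓ (C ⊔ S) ⋖ G 0 := by
    rw [inf_comm, h.sup_inf (Nat.zero_le _) h.covBy.le]
    exact h.covBy
  have h2 := covBy_sup_of_inf_covBy_left h1
  rwa [sup_left_comm, sup_eq_left.2 h.covBy.le] at h2

theorem krullDim_eq (h : IdealChain t C S G) : Order.krullDim α = ((t + 4 : ℕ) : WithBot ℕ∞) := by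
  -- The composition series is `⊥ ⋖ S ⋖ G 0 ⋖ ⋯ ⋖ G t ⋖ C ⊔ G t ⋖ ⊤`; the scalars enter only at the
  -- penultimate term.
  let c : ℕ → α := fun i => match i with
    | 0 => ⊥
    | 1 => S
    | k + 2 => if k ≤ t then G k else if k = t + 1 then C ⊔ G t else ⊤
  refine krullDim_eq_of_covBy_chain c (t + 4) rfl (by simp [c]) fun i hi => ?_
  match i with
  | 0 => exact bot_covBy_iff.2 h.isAtom_bot
  | 1 => exact h.covBy
  | k + 2 =>
    change (if k ≤ t then G k else if k = t + 1 then C ⊔ G t else ⊤) ⋖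
      (if k + 1 ≤ t then G (k + 1) else if k + 1 = t + 1 then C ⊔ G t else ⊤)
    rcases lt_trichotomy k t with hk | rfl | hk
    · rw [if_pos hk.le, if_pos (Nat.succ_le_of_lt hk)]
      exact h.covBy_succ hk
    · simpa using h.covBy_sup
    · obtain rfl : k = t + 1 := by omega
      simpa using h.sup_covBy_top

/-- The only atoms are `C` and `S`. From `C ⊔ S` on there is a unique cover at each step, until `C ⊔
G (t + 1) = ⊤`. -/
theorem soc_eq (h : IdealChain t C S G) {f : ℕ → α} (h0 : f 0 = ⊥)
    (hf : ∀ q, f (q + 1) = f q ⊔ sSup {E | f q ⋖ E}) :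
    f 1 = C ⊔ S ∧ ∀ s ≤ t + 1, f (s + 2) = C ⊔ G s := by
  have h1 : f 1 = C ⊔ S := by
    rw [hf, h0, bot_sup_eq]
    refine le_antisymm (sSup_le fun E hE => ?_) (sup_le (le_sSup (bot_covBy_iff.2 h.atom))
      (le_sSup (bot_covBy_iff.2 h.isAtom_bot)))
    by_cases hEC : E ≤ C
    · exact le_sup_of_le_left hEC
    · rcases (hE : ⊥ ⋖ E).eq_or_eq bot_le (h.le_of_not_le E hEC) with h' | h'
      · exact absurd h' h.ne_bot
      · exact le_sup_of_le_right h'.ge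
  refine ⟨h1, fun s => ?_⟩
  induction s with
  | zero =>
    intro _
    rw [hf, h1]
    refine sup_sSup_covBy h.sup_covBy_sup fun I hI => ?_
    by_cases hI0 : I ≤ C ⊔ G 0
    · rcases h.sup_covBy_sup.eq_or_eq hI.le hI0 with h' | h'
      · exact absurd h' hI.ne'
      · exact h'.ge
    · exact sup_le (le_sup_left.trans hI.le)
        ((h.mono (Nat.le_succ 0)).trans (h.succ_le_of_not_le 0 (Nat.zero_le _) I hI0))
  | succ s ih =>
    intro hs
    have hs' : s ≤ t := by omega
    rw [show s + 1 + 2 = (s + 2) + 1 by omega, hf, ih (by omega)]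
    exact sup_sSup_covBy (h.sup_covBy_sup_succ hs') fun I hI =>
      sup_le (le_sup_left.trans hI.le) (h.succ_le_of_not_le s hs' I hI.not_ge)

theorem rad_eq (h : IdealChain t C S G) {r : ℕ → α} (h0 : r 0 = ⊤)
    (hr : ∀ q, r (q + 1) = r q ⊓ sInf {F | F ⋖ r q}) :
    r 1 = C ⊔ G t ∧ (∀ s, 1 ≤ s → s ≤ t → r (s + 1) = G (t - s)) ∧ r (t + 2) = S := by
  have h1 : r 1 = C ⊔ G t := by
    rw [hr, h0, top_inf_eq]
    refine le_antisymm (sInf_le h.sup_covBy_top) (le_sInf fun F hF => ?_)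
    rcases h.le_or_eq_top F with hF' | rfl
    · rcases (hF : F ⋖ ⊤).eq_or_eq hF' le_top with h' | h'
      · exact h'.le
      · exact absurd h' h.sup_covBy_top.lt.ne
    · exact absurd rfl hF.lt.ne
  -- the radical of `C ⊔ G t`
  have key : ∀ X, X ≤ G t → C ⊔ X ⋖ C ⊔ G t →
      (∀ F, F ⋖ C ⊔ G t → X ≤ F) → r 2 = X := by
    intro X hX hcov hle
    rw [hr, h1]
    refine le_antisymm ?_ (le_inf (le_sup_of_le_right hX) (le_sInf hle))
    -- The two coatoms `C ⊔ X` and `G t` of `C ⊔ G t` meet in `X`; here the scalars leave the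
    -- radical filtration.
    refine inf_le_right.trans (le_trans (le_inf (sInf_le hcov) (sInf_le h.covBy_sup)) ?_)
    exact (h.sup_inf le_rfl hX).le
  have key' : ∀ s, 1 ≤ s → s ≤ t → r (s + 1) = G (t - s) := by
    intro s hs
    induction s, hs using Nat.le_induction with
    | base =>
      intro ht
      obtain ⟨u, rfl⟩ : ∃ u, t = u + 1 := ⟨t - 1, by omega⟩
      refine key _ (h.mono (Nat.sub_le _ _)) (h.sup_covBy_sup_succ (Nat.le_succ u)) fun F hF => ?_
      by_cases hFu : F ≤ C ⊔ G u
      · have hcov := h.sup_covBy_sup_succ (Nat.le_succ u)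
        rcases hF.eq_or_eq hFu hcov.le with h' | h'
        · exact h' ▸ le_sup_right
        · exact absurd h' hcov.lt.ne
      · exact (h.mono (Nat.le_succ u)).trans (h.succ_le_of_not_le u (Nat.le_succ u) F hFu)
    | succ s hs ih =>
      intro ht
      rw [hr, ih (by omega)]
      obtain ⟨u, hu, hu'⟩ : ∃ u, t - s = u + 1 ∧ t - (s + 1) = u := ⟨t - (s + 1), by omega, rfl⟩
      rw [hu, hu']
      have hcov := h.covBy_succ (show u < t by omega)
      refine le_antisymm (inf_le_right.trans (sInf_le hcov))
        (le_inf hcov.le (le_sInf fun F hF => ?_))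
      have hFu : F ≤ C ⊔ G u := by
        by_contra hcon
        exact (hF : F ⋖ _).lt.not_ge (h.succ_le_of_not_le u (by omega) F hcon)
      have hFu' : F ≤ G u := (le_inf hFu (hF : F ⋖ _).le).trans
        (h.sup_inf (by omega) hcov.le).le
      rcases (hF : F ⋖ _).eq_or_eq hFu' hcov.le with h' | h'
      · exact h'.le
      · exact absurd h' hcov.lt.ne
  refine ⟨h1, key', ?_⟩
  -- For `t = 0` the middle range is empty, and `S` is the radical of `C ⊔ G 0` instead of `G 0`.
  rcases Nat.eq_zero_or_pos t with rfl | ht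
  · refine key S h.covBy.le h.sup_covBy_sup fun F hF => h.le_of_not_le F fun hFC => ?_
    have hlt : C < C ⊔ S := lt_of_le_of_ne le_sup_left fun he =>
      h.ne_bot (le_bot_iff.1 ((le_inf (he ▸ le_sup_right) le_rfl).trans h.disjoint_bot.le))
    rcases hF.eq_or_eq (hFC.trans hlt.le) h.sup_covBy_sup.le with h' | h'
    · exact (h'.trans_le hFC).not_gt hlt
    · exact h.sup_covBy_sup.lt.ne h'
  · rw [hr, key' t ht le_rfl, Nat.sub_self]
    refine le_antisymm (inf_le_right.trans (sInf_le h.covBy))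
      (le_inf h.covBy.le (le_sInf fun F hF => h.le_of_not_le F fun hFC => ?_))
    have hF0 : F = ⊥ := le_bot_iff.1
      ((le_inf hFC (hF : F ⋖ _).le).trans (h.disjoint (Nat.zero_le t)).le)
    subst hF0
    exact (hF : ⊥ ⋖ _).2 (bot_lt_iff_ne_bot.2 h.ne_bot) h.covBy.lt

end

end IdealChain

/-! ## Operators with finite rows and columns -/

namespace Mackey

universe u

variable {B : Type u} {V W : Type*} [AddCommGroup V] [Module ℂ V] [AddCommGroup W] [Module ℂ W]
  (P : DiagonalPairing B V W)

/-- The matrix coefficients of an operator. -/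
noncomputable def entry (x : Module.End ℂ V) (a b : B) : ℂ :=
  P.basisV.repr (x (P.basisV b)) a

theorem entry_add (x y : Module.End ℂ V) (a b : B) :
    entry P (x + y) a b = entry P x a b + entry P y a b := by simp [entry]

theorem entry_sub (x y : Module.End ℂ V) (a b : B) :
    entry P (x - y) a b = entry P x a b - entry P y a b := by simp [entry]

theorem entry_ext {x y : Module.End ℂ V} (h : ∀ a b, entry P x a b = entry P y a b) : x = y :=
  P.basisV.ext fun b => P.basisV.repr.injective (Finsupp.ext fun a => h a b)

theorem finite_column (x : Module.End ℂ V) (b : B) : {a | entry P x a b ≠ 0}.Finite :=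
  (P.basisV.repr (x (P.basisV b))).hasFiniteSupport

/-- The functional `x^*(w_a)` has row `a` of the matrix as its coordinates, so it lies in `W`
exactly when that row is finite. Columns are always finite. -/
theorem mem_glM_iff {x : Module.End ℂ V} :
    x ∈ glM P.form ↔ ∀ a, {b | entry P x a b ≠ 0}.Finite := by
  constructor
  · intro hx a
    obtain ⟨w', hw'⟩ := exists_adjoint (⟨x, hx⟩ : glM P.form) (P.basisW a)
    refine (P.basisW.repr w').hasFiniteSupport.subset fun b hb => ?_
    have h := hw' (P.basisV b)
    rw [form_basis, basis_form] at h
    rw [Function.mem_support, ← h]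
    exact hb
  · intro h
    suffices hK : (LinearMap.range P.form.flip).comap (x.dualMap ∘ₗ P.form.flip) = ⊤ by
      rintro _ ⟨f, ⟨w, rfl⟩, rfl⟩
      exact (hK ▸ Submodule.mem_top :
        w ∈ (LinearMap.range P.form.flip).comap (x.dualMap ∘ₗ P.form.flip))
    rw [eq_top_iff, ← P.basisW.span_eq, Submodule.span_le]
    rintro _ ⟨a, rfl⟩
    refine ⟨P.basisW.repr.symm (Finsupp.ofSupportFinite (entry P x a) (h a)), ?_⟩
    refine P.basisV.ext fun b => ?_
    rw [LinearMap.flip_apply, basis_form, LinearEquiv.apply_symm_apply]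
    exact (form_basis P _ a).symm

theorem mul_mem_glM {x y : Module.End ℂ V} (hx : x ∈ glM P.form) (hy : y ∈ glM P.form) :
    x * y ∈ glM P.form := by
  rintro _ ⟨f, hf, rfl⟩
  exact hy ⟨_, hx ⟨f, hf, rfl⟩, rfl⟩

/-- The operator sending the basis vector `v_b` to `c_b v_{j b}`. -/
noncomputable def wt (j : B → B) (c : B → ℂ) : Module.End ℂ V :=
  P.basisV.constr ℂ fun b => c b • P.basisV (j b)

@[simp] theorem wt_basis (j : B → B) (c : B → ℂ) (b : B) :
    wt P j c (P.basisV b) = c b • P.basisV (j b) := P.basisV.constr_basis _ _ _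

theorem wt_mem {j : B → B} {c : B → ℂ} (h : Set.InjOn j {b | c b ≠ 0}) :
    wt P j c ∈ glM P.form := by
  classical
  rw [mem_glM_iff]
  intro a
  refine Set.Subsingleton.finite fun b hb b' hb' => ?_
  simp only [entry, wt_basis, map_smul, Module.Basis.repr_self, Finsupp.smul_apply,
    Finsupp.single_apply, smul_eq_mul, mul_ite, mul_one, mul_zero, ne_eq, ite_eq_right_iff,
    Classical.not_imp, Set.mem_ofPred_eq] at hb hb'
  exact h hb.2 hb'.2 (hb.1.trans hb'.1.symm)

theorem entry_mul_wt (x : Module.End ℂ V) (j : B → B) (c : B → ℂ) (a b : B) :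
    entry P (x * wt P j c) a b = c b * entry P x a (j b) := by simp [entry]

/-- By `h`, no other index of nonzero weight is sent to `j a`, so row `j a` of the product is `c a`
times row `a` of `x`. -/
theorem entry_wt_mul {j : B → B} {c : B → ℂ} (x : Module.End ℂ V) {a : B} (b : B)
    (h : ∀ k, c k ≠ 0 → j k = j a → k = a) :
    entry P (wt P j c * x) (j a) b = c a * entry P x a b := by
  classical
  have key : P.basisV.coord (j a) ∘ₗ wt P j c = c a • P.basisV.coord a := by
    refine P.basisV.ext fun k => ?_
    by_cases hk : c k = 0
    · by_cases hka : k = a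
      · subst hka; simp [hk]
      · simp [hk, hka]
    · by_cases hka : k = a
      · subst hka; simp
      · simp [hka, mt (h k hk) hka]
  exact LinearMap.congr_fun key (x (P.basisV b))

/-- The projection onto the span of the basis vectors with index in `A`. -/
noncomputable def proj (A : Set B) : Module.End ℂ V :=
  wt P id (A.indicator 1)

theorem proj_mem (A : Set B) : proj P A ∈ glM P.form := wt_mem P Function.injective_id.injOn

theorem proj_basis_of_mem {A : Set B} {b : B} (h : b ∈ A) :
    proj P A (P.basisV b) = P.basisV b := by simp [proj, h]

theorem proj_basis_of_notMem {A : Set B} {b : B} (h : b ∉ A) :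
    proj P A (P.basisV b) = 0 := by simp [proj, h]

theorem proj_mul_proj (A C : Set B) : proj P A * proj P C = proj P (A ∩ C) :=
  P.basisV.ext fun b => by
    by_cases hA : b ∈ A <;> by_cases hC : b ∈ C <;> simp [proj, hA, hC]

theorem proj_mul_self (A : Set B) : proj P A * proj P A = proj P A := by
  rw [proj_mul_proj, Set.inter_self]

theorem proj_mul_of_disjoint {A C : Set B} (h : Disjoint A C) : proj P A * proj P C = 0 := by
  rw [proj_mul_proj, h.inter_eq]
  exact P.basisV.ext fun b => by simp [proj]

theorem proj_union {A C : Set B} (h : Disjoint A C) :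
    proj P (A ∪ C) = proj P A + proj P C :=
  P.basisV.ext fun b => by
    by_cases hA : b ∈ A
    · have hC := Set.disjoint_left.1 h hA
      simp [proj, hA, hC]
    · by_cases hC : b ∈ C <;> simp [proj, hA, hC]

theorem entry_mul_proj (x : Module.End ℂ V) (A : Set B) (a b : B) :
    entry P (x * proj P A) a b = A.indicator 1 b * entry P x a b :=
  entry_mul_wt P x id _ a b

theorem entry_proj_mul (x : Module.End ℂ V) (A : Set B) (a b : B) :
    entry P (proj P A * x) a b = A.indicator 1 a * entry P x a b :=
  entry_wt_mul P (j := id) x b fun _ _ h => h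

/-- A partial injection from `D` to `C` and its inverse, as operators. -/
theorem exists_partial_iso {D C : Set B} (h : Cardinal.mk D ≤ Cardinal.mk C) :
    ∃ y ∈ glM P.form, ∃ z ∈ glM P.form, z * y = proj P D ∧ proj P C * y = y ∧
      y * proj P D = y ∧ proj P D * z = z := by
  classical
  obtain ⟨f⟩ := (Cardinal.le_def _ _).1 h
  let j : B → B := fun b => if hb : b ∈ D then f ⟨b, hb⟩ else b
  have hj : ∀ b (hb : b ∈ D), j b = f ⟨b, hb⟩ := fun b hb => dif_pos hb
  have hinj : Set.InjOn j D := by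
    intro a ha b hb hab
    rw [hj a ha, hj b hb] at hab
    exact congrArg Subtype.val (f.injective (Subtype.ext hab))
  have hmaps : ∀ b ∈ D, j b ∈ C := fun b hb => by rw [hj b hb]; exact (f _).2
  -- `Function.invFunOn` needs an inhabitant of `B`.
  rcases isEmpty_or_nonempty B with hB | hB
  · have : Subsingleton (Module.End ℂ V) := ⟨fun x y => P.basisV.ext fun b => hB.elim b⟩
    exact ⟨0, zero_mem _, 0, zero_mem _, Subsingleton.elim _ _, Subsingleton.elim _ _,
      Subsingleton.elim _ _, Subsingleton.elim _ _⟩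
  let k := Function.invFunOn j D
  have hk : ∀ b ∈ D, k (j b) = b := fun b hb => hinj.leftInvOn_invFunOn hb
  refine ⟨wt P j (D.indicator 1), wt_mem P ?_, wt P k ((j '' D).indicator 1), wt_mem P ?_,
    ?_, ?_, ?_, ?_⟩
  · exact hinj.mono fun b hb => by by_contra h'; simp [h'] at hb
  · have hsub : {b | (j '' D).indicator (1 : B → ℂ) b ≠ 0} ⊆ j '' D :=
      fun b hb => by by_contra h'; exact hb (Set.indicator_of_notMem h' _)
    refine Set.InjOn.mono hsub ?_
    rintro _ ⟨a, ha, rfl⟩ _ ⟨b, hb, rfl⟩ hab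
    rw [hk a ha, hk b hb] at hab
    rw [hab]
  · refine P.basisV.ext fun b => ?_
    by_cases hb : b ∈ D
    · have : j b ∈ j '' D := ⟨b, hb, rfl⟩
      simp only [Module.End.mul_apply, wt_basis, Set.indicator_of_mem hb,
        Set.indicator_of_mem this, proj_basis_of_mem P hb, hk b hb, Pi.one_apply, one_smul]
    · simp [hb, proj]
  · refine P.basisV.ext fun b => ?_
    by_cases hb : b ∈ D
    · simp [hb, proj, hmaps b hb]
    · simp [hb]
  · refine P.basisV.ext fun b => ?_
    by_cases hb : b ∈ D <;> simp [hb, proj]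
  · refine P.basisV.ext fun b => ?_
    by_cases hb : b ∈ j '' D
    · obtain ⟨a, ha, rfl⟩ := hb
      simp [proj, hk a ha, ha]
    · simp [Set.indicator_of_notMem hb]

end Mackey

/-! ### Matrix blocks contained in an ideal -/

namespace Mackey

universe u

variable {B : Type u} {V W : Type*} [AddCommGroup V] [Module ℂ V] [AddCommGroup W] [Module ℂ W]
  (P : DiagonalPairing B V W)

/-- A space of operators of `gl^M` that is stable under commutators with `gl^M`. -/
structure IsEndIdeal (I : Submodule ℂ (Module.End ℂ V)) : Prop where
  le : ∀ x ∈ I, x ∈ glM P.form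
  comm : ∀ x ∈ I, ∀ y ∈ glM P.form, x * y - y * x ∈ I

/-- All operators of `gl^M` from the span of `C` to the span of `A` belong to `I`. -/
def ContainsBlock (I : Submodule ℂ (Module.End ℂ V)) (A C : Set B) : Prop :=
  ∀ x ∈ glM P.form, proj P A * x * proj P C ∈ I

variable {P} {I : Submodule ℂ (Module.End ℂ V)}

namespace IsEndIdeal

/-- This replaces the missing closure of `I` under associative products; all transports of blocks
rest on it. -/
theorem mul_mem_of_eq_zero (hI : IsEndIdeal P I) {x y : Module.End ℂ V} (hx : x ∈ I)
    (hy : y ∈ glM P.form) (h : y * x = 0) : x * y ∈ I := by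
  simpa [h] using hI.comm x hx y hy

theorem mul_mem_of_eq_zero' (hI : IsEndIdeal P I) {x y : Module.End ℂ V} (hx : x ∈ I)
    (hy : y ∈ glM P.form) (h : x * y = 0) : y * x ∈ I := by
  have := neg_mem (hI.comm x hx y hy)
  simpa [h] using this

end IsEndIdeal

namespace ContainsBlock

theorem mono {A C A' C' : Set B} (h : ContainsBlock P I A C) (hA : A' ⊆ A) (hC : C' ⊆ C) :
    ContainsBlock P I A' C' := by
  intro x hx
  have key : proj P A' * x * proj P C' =
      proj P A * (proj P A' * x * proj P C') * proj P C := by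
    rw [← mul_assoc, ← mul_assoc, proj_mul_proj, Set.inter_eq_self_of_subset_right hA,
      mul_assoc _ (proj P C'), proj_mul_proj, Set.inter_eq_self_of_subset_left hC]
  rw [key]
  exact h _ (mul_mem_glM P (mul_mem_glM P (proj_mem P _) hx) (proj_mem P _))

/-- A partial isomorphism `y` from `D` into `C` is multiplied on the right. The opposite product
vanishes because `D` misses the rows `A`. -/
theorem right (hI : IsEndIdeal P I) {A C D : Set B} (h : ContainsBlock P I A C)
    (hD : Disjoint D A) (hcard : Cardinal.mk D ≤ Cardinal.mk C) : ContainsBlock P I A D := by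
  intro x hx
  obtain ⟨y, hy, z, hz, hzy, hCy, hyD, -⟩ := exists_partial_iso P hcard
  have key := hI.mul_mem_of_eq_zero (h (x * z) (mul_mem_glM P hx hz)) hy (by
    rw [← hyD, mul_assoc y, mul_assoc (proj P A), ← mul_assoc (proj P D),
      proj_mul_of_disjoint P hD, zero_mul, mul_zero])
  rwa [mul_assoc, hCy, mul_assoc, mul_assoc x, hzy, ← mul_assoc] at key

theorem left (hI : IsEndIdeal P I) {A C D : Set B} (h : ContainsBlock P I A C)
    (hD : Disjoint D C) (hcard : Cardinal.mk D ≤ Cardinal.mk A) : ContainsBlock P I D C := by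
  intro x hx
  obtain ⟨y, hy, z, hz, hzy, hAy, -, hDz⟩ := exists_partial_iso P hcard
  have key := hI.mul_mem_of_eq_zero' (h (y * x) (mul_mem_glM P hy hx)) hz (by
    rw [← hDz, mul_assoc, ← mul_assoc (proj P C), proj_mul_of_disjoint P hD.symm, zero_mul,
      mul_zero])
  rwa [← mul_assoc (proj P A), hAy, ← mul_assoc, ← mul_assoc, hzy] at key

theorem union_right {A C D : Set B} (hC : ContainsBlock P I A C) (hD : ContainsBlock P I A D)
    (h : Disjoint C D) : ContainsBlock P I A (C ∪ D) := by
  intro x hx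
  rw [proj_union P h, mul_add]
  exact add_mem (hC x hx) (hD x hx)

theorem union_left {A C D : Set B} (hA : ContainsBlock P I A C) (hD : ContainsBlock P I D C)
    (h : Disjoint A D) : ContainsBlock P I (A ∪ D) C := by
  intro x hx
  rw [proj_union P h, add_mul, add_mul]
  exact add_mem (hA x hx) (hD x hx)

/-- Two disjoint blocks in the same columns produce all smaller off-diagonal blocks. -/
theorem of_two (hI : IsEndIdeal P I) {A₁ A₂ C₀ A C : Set B} (h₁ : ContainsBlock P I A₁ C₀)
    (h₂ : ContainsBlock P I A₂ C₀) (hd : Disjoint A₁ A₂) (hAC : Disjoint A C)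
    (hA₁ : Cardinal.mk A ≤ Cardinal.mk A₁) (hA₂ : Cardinal.mk A ≤ Cardinal.mk A₂)
    (hC : Cardinal.mk C ≤ Cardinal.mk C₀) : ContainsBlock P I A C := by
  -- Columns outside `A₁` are reached from the block with rows `A₁`, columns inside `A₁` from the
  -- one with rows `A₂`; then the rows are moved to `A`.
  rw [← Set.sdiff_union_inter C A₁]
  refine union_right ?_ ?_ (Set.disjoint_left.2 fun b hb hb' => hb.2 hb'.2)
  · refine left hI (right hI h₁ Set.disjoint_sdiff_left
      ((Cardinal.mk_le_mk_of_subset Set.sdiff_subset).trans hC)) ?_ hA₁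
    exact hAC.mono_right Set.sdiff_subset
  · refine left hI (right hI h₂ (hd.mono_left Set.inter_subset_right)
      ((Cardinal.mk_le_mk_of_subset Set.inter_subset_left).trans hC)) ?_ hA₂
    exact hAC.mono_right Set.inter_subset_left

/-- A separated family of off-diagonal coefficients of an element of `I` produces a full block. -/
theorem of_separated (hI : IsEndIdeal P I) {x : Module.End ℂ V} (hx : x ∈ I) {D : Set B}
    {j : B → B} (hj : ∀ b ∈ D, j b ∉ D) (hne : ∀ b ∈ D, entry P x (j b) b ≠ 0)
    (hsep : ∀ b ∈ D, ∀ b' ∈ D, b ≠ b' → entry P x (j b') b = 0) :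
    ContainsBlock P I (j '' D) D := by
  classical
  rcases isEmpty_or_nonempty B with hB | hB
  · intro y _
    rw [show proj P (j '' D) * y * proj P D = 0 from P.basisV.ext fun b => hB.elim b]
    exact zero_mem _
  have hinj : Set.InjOn j D := by
    intro b hb b' hb' hbb
    by_contra hcon
    exact hne b hb (hbb ▸ hsep b hb b' hb' hcon)
  have hdisj : Disjoint (j '' D) D := by
    rw [Set.disjoint_left]
    rintro _ ⟨b, hb, rfl⟩ h
    exact hj b hb h
  have hef := proj_mul_of_disjoint P hdisj
  have hfe := proj_mul_of_disjoint P hdisj.symm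
  have hee := proj_mul_self P (j '' D)
  have hff := proj_mul_self P D
  have he := proj_mem P (j '' D)
  have hf := proj_mem P D
  set e := proj P (j '' D)
  set f := proj P D
  -- For orthogonal idempotents, `[[x, f], e] = -(exf + fxe)`, and one more bracket with `e` gives
  -- `exf - fxe`; half the difference is `exf`.
  have hz : e * x * f ∈ I := by
    have h1 := hI.comm _ (hI.comm x hx f hf) e he
    have h2 := hI.comm _ h1 e he
    have h1' : (x * f - f * x) * e - e * (x * f - f * x) = -(e * x * f + f * x * e) := by
      simp only [sub_mul, mul_sub, mul_assoc, hfe, mul_zero]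
      simp only [← mul_assoc, hef, zero_mul]
      abel
    have h2' : -(e * x * f + f * x * e) * e - e * -(e * x * f + f * x * e) =
        e * x * f - f * x * e := by
      simp only [neg_mul, mul_neg, add_mul, mul_add, mul_assoc, hfe, hee, mul_zero]
      simp only [← mul_assoc, hef, hee, zero_mul]
      abel
    rw [h1'] at h1 h2
    rw [h2'] at h2
    have h3 := I.smul_mem (1 / 2 : ℂ) (sub_mem h2 h1)
    convert h3 using 1
    module
  let k := Function.invFunOn j D
  have hk : ∀ b ∈ D, k (j b) = b := fun b hb => hinj.leftInvOn_invFunOn hb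
  let c : B → ℂ := fun b => entry P x (j b) b
  have hzb : ∀ b ∈ D, (e * x * f) (P.basisV b) = c b • P.basisV (j b) := by
    intro b hb
    refine P.basisV.repr.injective (Finsupp.ext fun a => ?_)
    change entry P (e * x * f) a b = _
    rw [entry_mul_proj, entry_proj_mul, Set.indicator_of_mem hb]
    by_cases ha : a ∈ j '' D
    · obtain ⟨b', hb', rfl⟩ := ha
      by_cases hbb : b = b'
      · subst hbb
        simp [c, Set.mem_image_of_mem j hb]
      · rw [hsep b hb b' hb' hbb]
        simp [hinj.ne hb' hb (Ne.symm hbb)]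
    · have : j b ≠ a := fun h => ha ⟨b, hb, h⟩
      simp [Set.indicator_of_notMem ha, this]
  -- By separation `exf` sends `v_b` to `c b` times `v_{j b}` on `D`, so this weighted inverse
  -- permutation gives `exf * y = e`.
  let y : Module.End ℂ V := wt P k ((j '' D).indicator fun a => (c (k a))⁻¹)
  have hy : y ∈ glM P.form := by
    refine wt_mem P (Set.InjOn.mono (s₂ := j '' D) ?_ ?_)
    · exact fun b hb => by by_contra h'; exact hb (Set.indicator_of_notMem h' _)
    · rintro _ ⟨a, ha, rfl⟩ _ ⟨b, hb, rfl⟩ hab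
      rw [hk a ha, hk b hb] at hab
      rw [hab]
  have hzy : e * x * f * y = e := by
    refine P.basisV.ext fun b => ?_
    by_cases hb : b ∈ j '' D
    · obtain ⟨a, ha, rfl⟩ := hb
      have h1 : y (P.basisV (j a)) = (c a)⁻¹ • P.basisV a := by
        simp [y, Set.indicator_of_mem (Set.mem_image_of_mem j ha), hk a ha]
      rw [Module.End.mul_apply, h1, map_smul, hzb a ha, smul_smul,
        inv_mul_cancel₀ (hne a ha), one_smul, proj_basis_of_mem P (Set.mem_image_of_mem j ha)]
    · have h1 : y (P.basisV b) = 0 := by simp [y, Set.indicator_of_notMem hb]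
      rw [Module.End.mul_apply, h1, map_zero, proj_basis_of_notMem P hb]
  intro w hw
  have key := hI.mul_mem_of_eq_zero hz (mul_mem_glM P (mul_mem_glM P hy hw) hf) (by
    rw [← mul_assoc, ← mul_assoc, mul_assoc _ f e, hfe, mul_zero, zero_mul, zero_mul])
  rwa [← mul_assoc, ← mul_assoc, hzy] at key

/-- A block on the diagonal, when there is room for infinitely many copies of it. -/
theorem diagonal_of_room (hI : IsEndIdeal P I) {κ : Cardinal.{u}} (hκ : Cardinal.aleph0 ≤ κ)
    (h : ∀ A C : Set B, Disjoint A C → Cardinal.mk A ≤ κ → Cardinal.mk C ≤ κ →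
      ContainsBlock P I A C)
    {A C : Set B} (hAC : Disjoint A C) (hA : Cardinal.mk A ≤ κ) (hC : Cardinal.mk C = κ) :
    ContainsBlock P I A A := by
  classical
  -- The swindle: `J` shifts copy `l` of `A` to copy `l + 1`, and `U` sends copy `l + 1` to copy `l`
  -- through `w` and kills copy `0`. Then `UJ - JU` is `w` cut down to `A`.
  intro w hw
  have hcard : Cardinal.mk (A × ℕ) ≤ Cardinal.mk C := by
    rw [Cardinal.mk_prod, Cardinal.mk_nat, Cardinal.lift_id', Cardinal.lift_aleph0, hC]
    exact (mul_le_mul' hA hκ).trans (Cardinal.mul_eq_self hκ).le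
  obtain ⟨g⟩ := (Cardinal.le_def _ _).1 hcard
  -- the copies of `A`
  obtain ⟨ψ, hψ0, hψ⟩ : ∃ ψ : A → ℕ → B, (∀ a, ψ a 0 = a) ∧
      ∀ a l a' l', ψ a l = ψ a' l' → a = a' ∧ l = l' := by
    -- Copy `0` is `A` itself, and the later copies lie in `C`, which is disjoint from `A`.
    refine ⟨fun a l => match l with
      | 0 => a
      | k + 1 => g (a, k), fun _ => rfl, ?_⟩
    intro a l a' l' hh
    rcases l with _ | k <;> rcases l' with _ | k'
    · exact ⟨Subtype.ext hh, rfl⟩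
    · have h1 : (a : B) = g (a', k') := hh
      exact absurd (h1 ▸ (g (a', k')).2) (Set.disjoint_left.1 hAC a.2)
    · have h1 : (g (a, k) : B) = a' := hh
      exact absurd (h1 ▸ (g (a, k)).2) (Set.disjoint_left.1 hAC a'.2)
    · have h1 := g.injective (Subtype.ext hh)
      simp only [Prod.mk.injEq] at h1
      exact ⟨h1.1, by rw [h1.2]⟩
  let dec : B → Option (A × ℕ) := fun i =>
    if hi : ∃ p : A × ℕ, ψ p.1 p.2 = i then some hi.choose else none
  have hdec : ∀ a l, dec (ψ a l) = some (a, l) := by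
    intro a l
    have hi : ∃ p : A × ℕ, ψ p.1 p.2 = ψ a l := ⟨(a, l), rfl⟩
    have := hψ _ _ _ _ hi.choose_spec
    simp only [dec, dif_pos hi]
    exact congrArg some (Prod.ext this.1 this.2)
  have hdec' : ∀ i a l, dec i = some (a, l) → i = ψ a l := by
    intro i a l hi
    by_cases hex : ∃ p : A × ℕ, ψ p.1 p.2 = i
    · simp only [dec, dif_pos hex, Option.some.injEq] at hi
      rw [← hex.choose_spec, hi]
    · simp only [dec, dif_neg hex, reduceCtorEq] at hi
  have hnone : ∀ i, dec i = none → i ∉ A := by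
    intro i hi hiA
    have := hdec ⟨i, hiA⟩ 0
    simp [hψ0, hi] at this
  have hext : ∀ x y : Module.End ℂ V, (∀ a l, x (P.basisV (ψ a l)) = y (P.basisV (ψ a l))) →
      (∀ i, dec i = none → x (P.basisV i) = y (P.basisV i)) → x = y := by
    intro x y h1 h2
    refine P.basisV.ext fun i => ?_
    match hi : dec i with
    | none => exact h2 i hi
    | some (a, l) => rw [hdec' i a l hi]; exact h1 a l
  clear_value dec
  -- the identification of the span of `A` with its `l`-th copy
  let T : ℕ → V →ₗ[ℂ] V := fun l => P.basisV.constr ℂ fun a =>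
    if ha : a ∈ A then P.basisV (ψ ⟨a, ha⟩ l) else 0
  have hT : ∀ (a : A) l, T l (P.basisV a) = P.basisV (ψ a l) := by
    intro a l; simp [T]
  have hT' : ∀ a ∉ A, ∀ l, T l (P.basisV a) = 0 := by
    intro a ha l; simp [T, ha]
  clear_value T
  have hT0 : T 0 = proj P A := P.basisV.ext fun b => by
    by_cases hb : b ∈ A
    · rw [proj_basis_of_mem P hb]; rw [hT ⟨b, hb⟩ 0, hψ0]
    · rw [proj_basis_of_notMem P hb, hT' b hb]
  let J : Module.End ℂ V := P.basisV.constr ℂ fun i => match dec i with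
    | none => 0
    | some (a, l) => P.basisV (ψ a (l + 1))
  have hJ : ∀ a l, J (P.basisV (ψ a l)) = P.basisV (ψ a (l + 1)) := by
    intro a l; simp [J, hdec]
  have hJ' : ∀ i, dec i = none → J (P.basisV i) = 0 := by
    intro i hi; simp [J, hi]
  let U : Module.End ℂ V := P.basisV.constr ℂ fun i => match dec i with
    | none => 0
    | some (_, 0) => 0
    | some (a, l + 1) => T l (w (P.basisV a))
  have hU0 : ∀ a, U (P.basisV (ψ a 0)) = 0 := by
    intro a; simp [U, hdec]
  have hU : ∀ a l, U (P.basisV (ψ a (l + 1))) = T l (w (P.basisV a)) := by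
    intro a l; simp [U, hdec]
  have hU' : ∀ i, dec i = none → U (P.basisV i) = 0 := by
    intro i hi; simp [U, hi]
  clear_value J U
  have hJT : ∀ l, J ∘ₗ T l = T (l + 1) := fun l => P.basisV.ext fun b => by
    by_cases hb : b ∈ A
    · rw [LinearMap.comp_apply, hT ⟨b, hb⟩ l, hT ⟨b, hb⟩ (l + 1), hJ]
    · rw [LinearMap.comp_apply, hT' b hb, hT' b hb, map_zero]
  have hJmem : J ∈ glM P.form := by
    rw [mem_glM_iff]
    intro i
    refine Set.Subsingleton.finite ?_
    have aux : ∀ b, entry P J i b ≠ 0 → ∃ a l, b = ψ a l ∧ i = ψ a (l + 1) := by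
      intro b hb
      match hdb : dec b with
      | none => exact absurd (by simp [entry, hJ' b hdb]) hb
      | some (a, l) =>
        obtain rfl := hdec' b a l hdb
        refine ⟨a, l, rfl, ?_⟩
        by_contra hcon
        exact hb (by simp [entry, hJ, Ne.symm hcon])
    intro b hb b' hb'
    obtain ⟨a, l, rfl, h1⟩ := aux b hb
    obtain ⟨a', l', rfl, h2⟩ := aux b' hb'
    obtain ⟨h3, h4⟩ := hψ _ _ _ _ (h1.symm.trans h2)
    rw [h3, Nat.succ_injective h4]
  -- coefficients of the copies
  have hTcoef : ∀ l v i, P.basisV.repr (T l v) i ≠ 0 →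
      ∃ a : A, i = ψ a l ∧ P.basisV.repr v a ≠ 0 := by
    intro l v i hi
    by_cases hex : ∃ a : A, i = ψ a l
    · obtain ⟨a, rfl⟩ := hex
      refine ⟨a, rfl, fun hcon => hi ?_⟩
      rw [← hcon]
      have hmap : P.basisV.coord (ψ a l) ∘ₗ T l = P.basisV.coord a := P.basisV.ext fun b => by
        by_cases hb : b ∈ A
        · rw [LinearMap.comp_apply, hT ⟨b, hb⟩]
          by_cases hba : b = a
          · subst hba; simp
          · have hne : ψ ⟨b, hb⟩ l ≠ ψ a l := fun hcon' =>
              hba (congrArg Subtype.val (hψ _ _ _ _ hcon').1)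
            simp [hba, hne]
        · have hba : b ≠ a := fun hcon' => hb (hcon' ▸ a.2)
          rw [LinearMap.comp_apply, hT' b hb]
          simp [hba]
      exact LinearMap.congr_fun hmap v
    · exfalso
      apply hi
      have hmap : P.basisV.coord i ∘ₗ T l = 0 := P.basisV.ext fun b => by
        by_cases hb : b ∈ A
        · rw [LinearMap.comp_apply, hT ⟨b, hb⟩]
          have hne : ψ ⟨b, hb⟩ l ≠ i := fun hcon' => hex ⟨_, hcon'.symm⟩
          simp [hne]
        · rw [LinearMap.comp_apply, hT' b hb]
          simp
      exact LinearMap.congr_fun hmap v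
  have hUcoef : ∀ i b, entry P U i b ≠ 0 →
      ∃ (a a' : A) (l : ℕ), b = ψ a (l + 1) ∧ i = ψ a' l ∧ entry P w a' a ≠ 0 := by
    intro i b hb
    match hdb : dec b with
    | none => exact absurd (by simp [entry, hU' b hdb]) hb
    | some (a, 0) =>
      obtain rfl := hdec' b a 0 hdb
      exact absurd (by simp [entry, hU0 a]) hb
    | some (a, l + 1) =>
      obtain rfl := hdec' b a (l + 1) hdb
      rw [entry, hU] at hb
      obtain ⟨a', hi, ha'⟩ := hTcoef _ _ _ hb
      exact ⟨a, a', l, rfl, hi, ha'⟩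
  have hUmem : U ∈ glM P.form := by
    rw [mem_glM_iff]
    intro i
    match hdi : dec i with
    | none =>
      convert Set.finite_empty
      refine Set.eq_empty_of_forall_notMem fun b hb => ?_
      obtain ⟨a, a', l, -, rfl, -⟩ := hUcoef i b hb
      simp [hdec] at hdi
    | some (a', l) =>
      obtain rfl := hdec' i a' l hdi
      refine (((mem_glM_iff P).1 hw a').preimage Subtype.val_injective.injOn |>.image
        fun a : A => ψ a (l + 1)).subset fun b hb => ?_
      obtain ⟨a, a'', l', rfl, h1, h2⟩ := hUcoef _ b hb
      obtain ⟨rfl, rfl⟩ := hψ _ _ _ _ h1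
      exact ⟨a, h2, rfl⟩
  -- even and odd copies
  let ev : Set B := {i | ∃ a l, i = ψ a (2 * l)}
  let od : Set B := {i | ∃ a l, i = ψ a (2 * l + 1)}
  have hdisj : Disjoint ev od := by
    rw [Set.disjoint_left]
    rintro _ ⟨a, l, rfl⟩ ⟨a', l', h'⟩
    have := (hψ _ _ _ _ h').2
    omega
  have hprod : Cardinal.mk (A × ℕ) ≤ κ := hC ▸ hcard
  have hev : Cardinal.mk ev ≤ κ := by
    refine (Cardinal.mk_le_of_surjective
      (f := fun p : A × ℕ => (⟨ψ p.1 (2 * p.2), p.1, p.2, rfl⟩ : ev)) ?_).trans hprod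
    rintro ⟨_, a, l, rfl⟩
    exact ⟨(a, l), rfl⟩
  have hod : Cardinal.mk od ≤ κ := by
    refine (Cardinal.mk_le_of_surjective
      (f := fun p : A × ℕ => (⟨ψ p.1 (2 * p.2 + 1), p.1, p.2, rfl⟩ : od)) ?_).trans hprod
    rintro ⟨_, a, l, rfl⟩
    exact ⟨(a, l), rfl⟩
  -- `U` lowers the copy index by one, hence exchanges even and odd copies and has only off-diagonal
  -- blocks.
  have hUsplit : U = proj P ev * U * proj P od + proj P od * U * proj P ev := by
    refine entry_ext P fun i b => ?_
    rw [entry_add, entry_mul_proj, entry_mul_proj, entry_proj_mul, entry_proj_mul]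
    by_cases hib : entry P U i b = 0
    · simp [hib]
    · obtain ⟨a, a', l, hb, hi, -⟩ := hUcoef i b hib
      rcases Nat.even_or_odd' l with ⟨m, rfl | rfl⟩
      · have h1 : i ∈ ev := ⟨a', m, hi⟩
        have h2 : b ∈ od := ⟨a, m, hb⟩
        simp [h1, h2, Set.disjoint_left.1 hdisj h1]
      · have h1 : i ∈ od := ⟨a', m, hi⟩
        have h2 : b ∈ ev := ⟨a, m + 1, hb⟩
        simp [h1, h2, Set.disjoint_right.1 hdisj h1]
  have hUI : U ∈ I := by
    rw [hUsplit]
    exact add_mem (h ev od hdisj hev hod U hUmem) (h od ev hdisj.symm hod hev U hUmem)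
  -- On copy `l + 1` both products act as `w` followed by the passage to copy `l + 1` and cancel; on
  -- copy `0` only `UJ` survives.
  have hcomm : U * J - J * U = proj P A * w * proj P A := by
    refine hext _ _ (fun a l => ?_) fun i hi => ?_
    · match l with
      | 0 =>
        have ha : P.basisV (ψ a 0) = P.basisV a := by rw [hψ0]
        simp only [LinearMap.sub_apply, Module.End.mul_apply, hJ, hU, hU0, map_zero, sub_zero,
          hT0]
        rw [ha, proj_basis_of_mem P a.2]
      | l + 1 =>
        have ha : ψ a (l + 1) ∉ A := fun hmem => by
          have := (hψ a (l + 1) ⟨_, hmem⟩ 0 (hψ0 ⟨_, hmem⟩).symm).2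
          omega
        have := LinearMap.congr_fun (hJT l) (w (P.basisV a))
        simp only [LinearMap.comp_apply] at this
        simp [hJ, hU, proj_basis_of_notMem P ha, this]
    · simp [hJ' i hi, hU' i hi, proj_basis_of_notMem P (hnone i hi)]
  rw [← hcomm]
  exact hI.comm U hUI J hJmem

/-- All blocks of cardinality at most `κ` belong to `I` if the off-diagonal ones do. -/
theorem of_forall_disjoint (hI : IsEndIdeal P I) {κ : Cardinal.{u}} (hκ : Cardinal.aleph0 ≤ κ)
    (hB : κ ≤ Cardinal.mk B)
    (h : ∀ A C : Set B, Disjoint A C → Cardinal.mk A ≤ κ → Cardinal.mk C ≤ κ →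
      ContainsBlock P I A C)
    {T : Set B} (hT : Cardinal.mk T ≤ κ) : ContainsBlock P I T T := by
  -- `T` is enlarged to cardinality exactly `κ` and halved; each half offers the room needed for the
  -- diagonal block of the other.
  obtain ⟨T₀, hT₀⟩ := Cardinal.le_mk_iff_exists_set.1 hB
  have hcard : Cardinal.mk (T ∪ T₀ : Set B) = κ := by
    apply le_antisymm
    · exact (Cardinal.mk_union_le _ _).trans (Cardinal.add_le_of_le hκ hT hT₀.le)
    · rw [← hT₀]; exact Cardinal.mk_le_mk_of_subset Set.subset_union_right
  have hinf : (T ∪ T₀ : Set B).Infinite := by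
    rw [← Set.infinite_coe_iff, Cardinal.infinite_iff, hcard]; exact hκ
  obtain ⟨T₁, T₂, hunion, hdisj, hcard'⟩ := hinf.exists_union_disjoint_cardinal_eq_of_infinite
  have hT₁ : Cardinal.mk T₁ = κ := by
    have := Cardinal.mk_union_of_disjoint hdisj
    rw [hunion, hcard, ← hcard'] at this
    have hinf' : Cardinal.aleph0 ≤ Cardinal.mk T₁ := by
      by_contra hcon
      exact (this ▸ hκ).not_gt (Cardinal.add_lt_aleph0 (not_le.1 hcon) (not_le.1 hcon))
    rw [this, Cardinal.add_eq_self hinf']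
  have hT₂ : Cardinal.mk T₂ = κ := hcard' ▸ hT₁
  refine mono (A := T ∪ T₀) (C := T ∪ T₀) ?_ Set.subset_union_left Set.subset_union_left
  rw [← hunion]
  refine union_right (union_left ?_ ?_ hdisj) (union_left ?_ ?_ hdisj) hdisj
  · exact diagonal_of_room hI hκ h hdisj hT₁.le hT₂
  · exact h _ _ hdisj.symm hT₂.le hT₁.le
  · exact h _ _ hdisj hT₁.le hT₂.le
  · exact diagonal_of_room hI hκ h hdisj.symm hT₂.le hT₁

end ContainsBlock

end Mackey

/-! ## Independent families -/

/-- Every set contains a maximal independent subset for a symmetric relation. -/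
theorem exists_maximal_independent {X : Type*} (r : X → X → Prop) (hr : ∀ x y, r x y → r y x)
    (S : Set X) : ∃ T ⊆ S, T.Pairwise (fun x y => ¬ r x y) ∧
      ∀ y ∈ S, y ∉ T → ∃ x ∈ T, r x y := by
  obtain ⟨T, hT⟩ := zorn_subset {T | T ⊆ S ∧ T.Pairwise fun x y => ¬ r x y} (by
    intro c hc hchain
    refine ⟨⋃₀ c, ⟨Set.sUnion_subset fun s hs => (hc hs).1, ?_⟩,
      fun s hs => Set.subset_sUnion_of_mem hs⟩
    exact (Set.pairwise_sUnion hchain.directedOn).2 fun s hs => (hc hs).2)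
  refine ⟨T, hT.prop.1, hT.prop.2, fun y hy hyT => ?_⟩
  by_contra! hcon
  refine hyT (hT.le_of_ge (y := insert y T) ⟨Set.insert_subset hy hT.prop.1, ?_⟩
    (Set.subset_insert y T) (Set.mem_insert y T))
  exact (Set.pairwise_insert_of_notMem hyT).2 ⟨hT.prop.2, fun x hx =>
    ⟨fun h => hcon x hx (hr _ _ h), hcon x hx⟩⟩

/-- A locally finite relation has independent sets of any infinite cardinality that is not larger
than the ambient set. -/
theorem exists_independent_of_finite {X : Type*} (r : X → X → Prop) (hr : ∀ x y, r x y → r y x)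
    {κ : Cardinal} (hκ : Cardinal.aleph0 ≤ κ) (S : Set X) (hS : κ ≤ Cardinal.mk S)
    (hfin : ∀ x ∈ S, {y ∈ S | r x y}.Finite) :
    ∃ T ⊆ S, κ ≤ Cardinal.mk T ∧ T.Pairwise fun x y => ¬ r x y := by
  obtain ⟨T, hTS, hpair, hmax⟩ := exists_maximal_independent r hr S
  refine ⟨T, hTS, ?_, hpair⟩
  by_contra! hlt
  refine hS.not_gt ?_
  -- By maximality, `T` and its finite neighbourhoods cover `S`; if `T` were smaller than `κ`, so
  -- would `S` be.
  have hsub : S ⊆ T ∪ ⋃ x : T, {y ∈ S | r x y} := by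
    intro y hy
    by_cases hyT : y ∈ T
    · exact Or.inl hyT
    · obtain ⟨x, hx, hxy⟩ := hmax y hy hyT
      exact Or.inr (Set.mem_iUnion.2 ⟨⟨x, hx⟩, hy, hxy⟩)
  refine (Cardinal.mk_le_mk_of_subset hsub).trans_lt ((Cardinal.mk_union_le _ _).trans_lt
    (Cardinal.add_lt_of_lt hκ hlt ?_))
  rcases T.finite_or_infinite with hT | hT
  · have := hT.to_subtype
    refine lt_of_lt_of_le ?_ hκ
    rw [Cardinal.lt_aleph0_iff_set_finite]
    exact Set.finite_iUnion fun x => hfin x (hTS x.2)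
  · have := hT.to_subtype
    refine lt_of_le_of_lt ((Cardinal.mk_iUnion_le _).trans ?_) hlt
    refine (mul_le_mul_right (ciSup_le' fun x => ?_) _).trans
      (Cardinal.mul_eq_left (Cardinal.aleph0_le_mk T) (Cardinal.aleph0_le_mk T)
        Cardinal.aleph0_ne_zero).le
    exact (Cardinal.lt_aleph0_iff_set_finite.2 (hfin x (hTS x.2))).le

namespace Mackey

universe u

variable {B : Type u} {V W : Type*} [AddCommGroup V] [Module ℂ V] [AddCommGroup W] [Module ℂ W]
  {P : DiagonalPairing B V W} {I : Submodule ℂ (Module.End ℂ V)}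

/-! ## Ideals generated by an operator -/

/-- Many columns with off-diagonal coefficients contain a large separated family. -/
theorem exists_separated {x : Module.End ℂ V} (hx : x ∈ glM P.form) {κ : Cardinal.{u}}
    (hκ : Cardinal.aleph0 ≤ κ) (h : κ ≤ Cardinal.mk {b : B | ∃ a, a ≠ b ∧ entry P x a b ≠ 0}) :
    ∃ (D : Set B) (j : B → B), κ ≤ Cardinal.mk D ∧ (∀ b ∈ D, j b ∉ D) ∧
      (∀ b ∈ D, entry P x (j b) b ≠ 0) ∧
      ∀ b ∈ D, ∀ b' ∈ D, b ≠ b' → entry P x (j b') b = 0 := by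
  classical
  rw [mem_glM_iff] at hx
  set S : Set B := {b : B | ∃ a, a ≠ b ∧ entry P x a b ≠ 0} with hSdef
  have hex : ∀ b, ∃ a, b ∈ S → a ≠ b ∧ entry P x a b ≠ 0 := fun b => by
    by_cases hb : b ∈ S
    · obtain ⟨a, ha⟩ := hb
      exact ⟨a, fun _ => ha⟩
    · exact ⟨b, fun h => absurd h hb⟩
  choose j hj using hex
  -- The relation collects all obstructions to separating two columns. It is locally finite because
  -- rows and columns are finite.
  let r : B → B → Prop := fun b b' =>
    (entry P x (j b) b' ≠ 0 ∨ entry P x (j b') b ≠ 0) ∨ (j b = b' ∨ j b' = b)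
  obtain ⟨D, hDS, hcard, hpair⟩ := exists_independent_of_finite r
    (fun b b' hbb => hbb.imp Or.symm Or.symm) hκ S h (by
      intro b hb
      have h1 : {b' | entry P x (j b) b' ≠ 0}.Finite := hx _
      have h2 : (⋃ a ∈ {a | entry P x a b ≠ 0}, {b' | entry P x a b' ≠ 0}).Finite :=
        (finite_column P x b).biUnion fun a _ => hx a
      have h3 : {b' | entry P x b b' ≠ 0}.Finite := hx _
      refine (((h1.union h2).union (Set.finite_singleton (j b))).union h3).subset ?_
      rintro b' ⟨hb', (hr | hr) | (hr | hr)⟩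
      · exact Or.inl (Or.inl (Or.inl hr))
      · exact Or.inl (Or.inl (Or.inr (Set.mem_biUnion hr (hj b' hb').2)))
      · exact Or.inl (Or.inr hr.symm)
      · exact Or.inr (hr ▸ (hj b' hb').2))
  refine ⟨D, j, hcard, fun b hb hjb => ?_, fun b hb => (hj b (hDS hb)).2,
    fun b hb b' hb' hne => ?_⟩
  · exact hpair hb hjb (hj b (hDS hb)).1.symm (Or.inr (Or.inl rfl))
  · by_contra hcon
    exact hpair hb hb' hne (Or.inl (Or.inr hcon))

/-- Commutators with partial permutations turn differences of diagonal coefficients into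
off-diagonal coefficients. -/
theorem IsEndIdeal.exists_offDiagonal (hI : IsEndIdeal P I) {x : Module.End ℂ V} (hx : x ∈ I)
    {D : Set B} {j : B → B} (hinj : Set.InjOn j D)
    (hne : ∀ b ∈ D, entry P x (j b) (j b) ≠ entry P x b b) :
    ∃ y ∈ I, ∀ b ∈ D, entry P y (j b) b ≠ 0 := by
  classical
  have hsupp : ∀ b, D.indicator (1 : B → ℂ) b ≠ 0 → b ∈ D := fun b hb => by
    by_contra h'; exact hb (Set.indicator_of_notMem h' _)
  refine ⟨_, hI.comm x hx (wt P j (D.indicator 1)) (wt_mem P (hinj.mono hsupp)), fun b hb => ?_⟩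
  -- The `(j b, b)` entry of the commutator is the difference of the diagonal entries of `x` at `j
  -- b` and `b`.
  rw [entry_sub, entry_mul_wt, entry_wt_mul P x b fun k hk hkb => hinj (hsupp k hk) hb hkb]
  simpa [hb, sub_eq_zero] using hne b hb

/-- An operator which is not scalar up to fewer than `κ` columns has, after a commutator, at least
`κ` columns with off-diagonal coefficients. -/
theorem IsEndIdeal.exists_many_offDiagonal (hI : IsEndIdeal P I) {x : Module.End ℂ V} (hx : x ∈ I)
    {κ : Cardinal.{u}} (hκ : Cardinal.aleph0 ≤ κ)
    (h : ∀ c : ℂ, κ ≤ Cardinal.mk {b : B | x (P.basisV b) ≠ c • P.basisV b}) :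
    ∃ y ∈ I, κ ≤ Cardinal.mk {b : B | ∃ a, a ≠ b ∧ entry P y a b ≠ 0} := by
  classical
  by_cases hoff : κ ≤ Cardinal.mk {b : B | ∃ a, a ≠ b ∧ entry P x a b ≠ 0}
  · exact ⟨x, hx, hoff⟩
  push Not at hoff
  let d : B → ℂ := fun b => entry P x b b
  -- `T` will be a maximal family of disjoint pairs with different diagonal entries. A large `T`
  -- gives the partial permutation for `exists_offDiagonal`; a small one forces the diagonal to be
  -- constant outside the indices it uses, against `h`.
  let r : B × B → B × B → Prop := fun p q =>
    (p.1 = q.1 ∨ p.2 = q.2) ∨ (p.1 = q.2 ∨ p.2 = q.1)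
  obtain ⟨T, hTS, hpair, hmax⟩ := exists_maximal_independent r
    (fun p q hpq => by
      rcases hpq with (hpq | hpq) | (hpq | hpq)
      · exact Or.inl (Or.inl hpq.symm)
      · exact Or.inl (Or.inr hpq.symm)
      · exact Or.inr (Or.inr hpq.symm)
      · exact Or.inr (Or.inl hpq.symm)) {p : B × B | d p.1 ≠ d p.2}
  by_cases hT : κ ≤ Cardinal.mk T
  · have hsnd : Set.InjOn Prod.snd T := by
      intro p hp q hq hpq
      by_contra hne
      exact hpair hp hq hne (Or.inl (Or.inr hpq))
    have hfst : Set.InjOn Prod.fst T := by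
      intro p hp q hq hpq
      by_contra hne
      exact hpair hp hq hne (Or.inl (Or.inl hpq))
    let j : B → B := fun b => if hb : ∃ p ∈ T, p.2 = b then hb.choose.1 else b
    have hj : ∀ p ∈ T, j p.2 = p.1 := by
      intro p hp
      have hb : ∃ q ∈ T, q.2 = p.2 := ⟨p, hp, rfl⟩
      have : hb.choose = p := hsnd hb.choose_spec.1 hp hb.choose_spec.2
      simp only [j, dif_pos hb, this]
    have hj' : ∀ b ∈ Prod.snd '' T, j b ∉ Prod.snd '' T := by
      rintro _ ⟨p, hp, rfl⟩ ⟨q, hq, hpq⟩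
      rw [hj p hp] at hpq
      by_cases hne : p = q
      · subst hne
        exact hTS hp (by rw [hpq])
      · exact hpair hp hq hne (Or.inr (Or.inl hpq.symm))
    obtain ⟨y, hy, hyne⟩ := hI.exists_offDiagonal hx (D := Prod.snd '' T) (j := j) (by
        rintro _ ⟨p, hp, rfl⟩ _ ⟨q, hq, rfl⟩ hpq
        rw [hj p hp, hj q hq] at hpq
        rw [hfst hp hq hpq]) (by
        rintro _ ⟨p, hp, rfl⟩
        rw [hj p hp]
        exact hTS hp)
    refine ⟨y, hy, ?_⟩
    rw [← Cardinal.mk_image_eq_of_injOn _ _ hsnd] at hT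
    refine hT.trans (Cardinal.mk_le_mk_of_subset fun b hb => ⟨j b, fun hcon => ?_, hyne b hb⟩)
    exact hj' b hb (hcon.symm ▸ hb)
  · exfalso
    push Not at hT
    set U : Set B := Prod.fst '' T ∪ Prod.snd '' T
    have hU : Cardinal.mk U < κ := (Cardinal.mk_union_le _ _).trans_lt
      (Cardinal.add_lt_of_lt hκ (Cardinal.mk_image_le.trans_lt hT)
        (Cardinal.mk_image_le.trans_lt hT))
    have hconst : ∃ c, ∀ b ∉ U, d b = c := by
      by_cases hex : ∃ b₀, b₀ ∉ U
      · obtain ⟨b₀, hb₀⟩ := hex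
        refine ⟨d b₀, fun b hb => ?_⟩
        by_contra hne
        have hnot : (b, b₀) ∉ T := fun hmem => hb (Or.inl ⟨_, hmem, rfl⟩)
        obtain ⟨p, hp, (hr | hr) | (hr | hr)⟩ := hmax (b, b₀) hne hnot
        · exact hb (Or.inl ⟨p, hp, hr⟩)
        · exact hb₀ (Or.inr ⟨p, hp, hr⟩)
        · exact hb₀ (Or.inl ⟨p, hp, hr⟩)
        · exact hb (Or.inr ⟨p, hp, hr⟩)
      · push Not at hex
        exact ⟨0, fun b hb => absurd (hex b) hb⟩
    obtain ⟨c, hc⟩ := hconst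
    refine (h c).not_gt (lt_of_le_of_lt (Cardinal.mk_le_mk_of_subset
      (t := {b : B | ∃ a, a ≠ b ∧ entry P x a b ≠ 0} ∪ U) fun b hb => ?_)
      ((Cardinal.mk_union_le _ _).trans_lt (Cardinal.add_lt_of_lt hκ hoff hU)))
    by_contra hcon
    simp only [Set.mem_union, Set.mem_ofPred_eq, not_or, not_exists, not_and, not_not] at hcon
    refine hb (P.basisV.repr.injective (Finsupp.ext fun a => ?_))
    by_cases hab : a = b
    · subst hab
      simpa [d, entry] using hc a hcon.2
    · simpa [Ne.symm hab, entry] using hcon.1 a hab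

/-- An ideal containing an operator that is not scalar up to fewer than `κ` columns contains all
blocks of cardinality at most `κ`. -/
theorem IsEndIdeal.containsBlock (hI : IsEndIdeal P I) {x : Module.End ℂ V} (hx : x ∈ I)
    {κ : Cardinal.{u}} (hκ : Cardinal.aleph0 ≤ κ)
    (h : ∀ c : ℂ, κ ≤ Cardinal.mk {b : B | x (P.basisV b) ≠ c • P.basisV b})
    {T : Set B} (hT : Cardinal.mk T ≤ κ) : ContainsBlock P I T T := by
  obtain ⟨y, hy, hoff⟩ := hI.exists_many_offDiagonal hx hκ h
  obtain ⟨D, j, hD, hj, hne, hsep⟩ := exists_separated (hI.le y hy) hκ hoff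
  have hblock := ContainsBlock.of_separated hI hy hj hne hsep
  have hinj : Set.InjOn j D := by
    intro b hb b' hb' hbb
    by_contra hcon
    exact hne b hb (hbb ▸ hsep b hb b' hb' hcon)
  have hD' : κ ≤ Cardinal.mk (j '' D) := by rwa [Cardinal.mk_image_eq_of_injOn _ _ hinj]
  have hinf : (j '' D).Infinite := by
    rw [← Set.infinite_coe_iff, Cardinal.infinite_iff]; exact hκ.trans hD'
  -- Halving the rows provides the two blocks over the same columns that `ContainsBlock.of_two`
  -- requires.
  obtain ⟨A₁, A₂, hunion, hdisj, hcard⟩ := hinf.exists_union_disjoint_cardinal_eq_of_infinite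
  have hA₁ : κ ≤ Cardinal.mk A₁ := by
    by_contra! hlt
    rw [← hunion] at hD'
    exact hD'.not_gt ((Cardinal.mk_union_le _ _).trans_lt
      (Cardinal.add_lt_of_lt hκ hlt (hcard ▸ hlt)))
  have hA₂ : κ ≤ Cardinal.mk A₂ := hcard ▸ hA₁
  refine ContainsBlock.of_forall_disjoint hI hκ
    (hD.trans (Cardinal.mk_set_le D)) (fun A C hAC hA hC => ?_) hT
  exact ContainsBlock.of_two hI (hblock.mono (hunion ▸ Set.subset_union_left) subset_rfl)
    (hblock.mono (hunion ▸ Set.subset_union_right) subset_rfl) hdisj hAC (hA.trans hA₁)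
    (hA.trans hA₂) (hC.trans hD)

/-- An ideal containing a nonscalar operator contains all elementary off-diagonal matrices. -/
theorem IsEndIdeal.containsBlock_singleton (hI : IsEndIdeal P I) [Infinite B]
    {x : Module.End ℂ V} (hx : x ∈ I) (h : ∀ c : ℂ, x ≠ c • LinearMap.id) {a b : B}
    (hab : a ≠ b) : ContainsBlock P I {a} {b} := by
  classical
  obtain ⟨y, hy, a₀, b₀, hne, hy0⟩ : ∃ y ∈ I, ∃ a₀ b₀, a₀ ≠ b₀ ∧ entry P y a₀ b₀ ≠ 0 := by
    by_cases hoff : ∃ a₀ b₀, a₀ ≠ b₀ ∧ entry P x a₀ b₀ ≠ 0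
    · exact ⟨x, hx, hoff⟩
    push Not at hoff
    have hdiag : ∃ a₀ b₀, entry P x a₀ a₀ ≠ entry P x b₀ b₀ := by
      by_contra! hcon
      refine h (entry P x a a) (P.basisV.ext fun b' => P.basisV.repr.injective
        (Finsupp.ext fun a' => ?_))
      by_cases hab' : a' = b'
      · subst hab'
        simpa [entry] using hcon a' a
      · simpa [Ne.symm hab', entry] using hoff a' b' hab'
    obtain ⟨a₀, b₀, hd⟩ := hdiag
    have hne : a₀ ≠ b₀ := fun hcon => hd (by rw [hcon])
    obtain ⟨y, hy, hyne⟩ := hI.exists_offDiagonal hx (D := {b₀}) (j := fun _ => a₀)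
      (Set.injOn_singleton _ _) (by simpa using hd)
    exact ⟨y, hy, a₀, b₀, hne, hyne b₀ rfl⟩
  have hblock := ContainsBlock.of_separated hI hy (D := {b₀}) (j := fun _ => a₀)
    (by simpa using hne) (by simpa using hy0)
    (fun b hb b' hb' hbb => absurd (hb.trans hb'.symm) hbb)
  rw [Set.image_singleton] at hblock
  -- A single row cannot be halved, so a third index supplies the second block for
  -- `ContainsBlock.of_two`.
  obtain ⟨c, hc⟩ := Infinite.exists_notMem_finset ({a₀, b₀} : Finset B)
  simp only [Finset.mem_insert, Finset.mem_singleton, not_or] at hc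
  have hone : ∀ i k : B, Cardinal.mk ({i} : Set B) ≤ Cardinal.mk ({k} : Set B) := by simp
  exact ContainsBlock.of_two hI hblock
    (ContainsBlock.left hI hblock (Set.disjoint_singleton.2 hc.2) (hone _ _))
    (Set.disjoint_singleton.2 (Ne.symm hc.1)) (Set.disjoint_singleton.2 hab)
    (hone _ _) (hone _ _) (hone _ _)

end Mackey

namespace Mackey

universe u

variable {B : Type u} {V W : Type*} [AddCommGroup V] [Module ℂ V] [AddCommGroup W] [Module ℂ W]
  (P : DiagonalPairing B V W)

/-! ## The ideals of the Mackey Lie algebra -/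

/-- An ideal of `gl^M` as a space of operators. -/
def endIdeal (I : LieIdeal ℂ (glM P.form)) : Submodule ℂ (Module.End ℂ V) :=
  I.toSubmodule.map (glM P.form).toSubmodule.subtype

theorem coe_mem_endIdeal {I : LieIdeal ℂ (glM P.form)} {x : glM P.form} :
    (x : Module.End ℂ V) ∈ endIdeal P I ↔ x ∈ I := by
  refine ⟨?_, fun h => ⟨x, h, rfl⟩⟩
  rintro ⟨y, hy, hyx⟩
  rwa [← Subtype.ext hyx]

theorem isEndIdeal_endIdeal (I : LieIdeal ℂ (glM P.form)) : IsEndIdeal P (endIdeal P I) where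
  le := by
    rintro _ ⟨x, -, rfl⟩
    exact x.2
  comm := by
    rintro _ ⟨x, hx, rfl⟩ y hy
    refine ⟨-⁅(⟨y, hy⟩ : glM P.form), x⁆, neg_mem (I.lie_mem hx), ?_⟩
    exact neg_sub (y * (x : Module.End ℂ V)) (x * y)

/-- Otherwise `ℵ_s` nonzero columns with pairwise disjoint supports exist. A functional equal to `1`
at one chosen index of each support and `0` elsewhere is pulled back to one that is nonzero on all
of them. -/
theorem card_lt_of_forall_mem_dualFilt {x : Module.End ℂ V} (hx : x ∈ glM P.form) {s : ℕ}
    (h : ∀ f : Module.Dual ℂ V, x.dualMap f ∈ dualFilt P s) :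
    Cardinal.mk {b : B | x (P.basisV b) ≠ 0} < Cardinal.aleph (s : Ordinal.{u}) := by
  classical
  rw [mem_glM_iff] at hx
  by_contra! hlt
  let r : B → B → Prop := fun b b' => ∃ a, entry P x a b ≠ 0 ∧ entry P x a b' ≠ 0
  obtain ⟨T, hTS, hcard, hpair⟩ := exists_independent_of_finite r
    (fun b b' ⟨a, h1, h2⟩ => ⟨a, h2, h1⟩) (Cardinal.aleph0_le_aleph _) _ hlt (by
      intro b _
      refine ((finite_column P x b).biUnion fun a _ => hx a).subset ?_
      rintro b' ⟨-, a, h1, h2⟩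
      exact Set.mem_biUnion h1 h2)
  have hex : ∀ b : T, ∃ a, entry P x a b ≠ 0 := by
    intro b
    by_contra! hcon
    exact hTS b.2 (P.basisV.repr.injective (Finsupp.ext fun a => by simpa [entry] using hcon a))
  choose α hα using hex
  let f : Module.Dual ℂ V := P.basisV.constr ℂ fun i => if ∃ b, α b = i then (1 : ℂ) else 0
  have hf : T ⊆ {b : B | x.dualMap f (P.basisV b) ≠ 0} := by
    intro b hb
    have hval : f (x (P.basisV b)) = entry P x (α ⟨b, hb⟩) b := by
      rw [Module.Basis.constr_apply, Finsupp.sum, Finset.sum_eq_single (α ⟨b, hb⟩)]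
      · simp [entry]
      · intro i hi hne
        rw [if_neg, smul_zero]
        rintro ⟨b', rfl⟩
        refine hne (congrArg α (Subtype.ext ?_))
        by_contra hbb
        exact hpair b'.2 hb hbb ⟨α b', hα b', Finsupp.mem_support_iff.1 hi⟩
      · intro hi
        rw [Finsupp.notMem_support_iff.1 hi, zero_smul]
    change f (x (P.basisV b)) ≠ 0
    rw [hval]
    exact hα ⟨b, hb⟩
  exact (hcard.trans (Cardinal.mk_le_mk_of_subset hf)).not_gt (h f)

theorem mem_glMs_iff {s : ℕ} {x : glM P.form} : x ∈ glMs P s ↔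
    Cardinal.mk {b : B | (x : Module.End ℂ V) (P.basisV b) ≠ 0} <
      Cardinal.aleph (s : Ordinal.{u}) := by
  refine ⟨card_lt_of_forall_mem_dualFilt P x.2, fun h f => ?_⟩
  refine (Cardinal.mk_le_mk_of_subset ?_).trans_lt h
  intro b hb hcon
  refine hb ?_
  simp [hcon]

theorem mem_scalars_sup_glMs_iff {s : ℕ} {x : glM P.form} :
    x ∈ scalars P.form ⊔ glMs P s ↔ ∃ c : ℂ,
      Cardinal.mk {b : B | (x : Module.End ℂ V) (P.basisV b) ≠ c • P.basisV b} <
        Cardinal.aleph (s : Ordinal.{u}) := by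
  rw [LieSubmodule.mem_sup]
  constructor
  · rintro ⟨y, ⟨c, hc⟩, z, hz, rfl⟩
    refine ⟨c, (Cardinal.mk_le_mk_of_subset ?_).trans_lt ((mem_glMs_iff P).1 hz)⟩
    intro b hb hcon
    refine hb ?_
    simp [hc, hcon]
  · rintro ⟨c, hc⟩
    have hid : LinearMap.id ∈ glM P.form := by
      rintro _ ⟨f, hf, rfl⟩
      exact hf
    let y : glM P.form := c • ⟨LinearMap.id, hid⟩
    refine ⟨y, ⟨c, rfl⟩, x - y, (mem_glMs_iff P).2 ?_, add_sub_cancel _ _⟩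
    refine (Cardinal.mk_le_mk_of_subset ?_).trans_lt hc
    intro b hb hcon
    refine hb ?_
    simp [y, hcon]

theorem glMs_mono : Monotone (glMs P) := by
  intro s s' hs x hx
  rw [mem_glMs_iff] at hx ⊢
  exact hx.trans_le (Cardinal.aleph_le_aleph.2 (Nat.cast_le.2 hs))

theorem mk_le_aleph_of_lt {X : Type u} {s : ℕ}
    (h : Cardinal.mk X < Cardinal.aleph ((s + 1 : ℕ) : Ordinal.{u})) :
    Cardinal.mk X ≤ Cardinal.aleph (s : Ordinal.{u}) := by
  rw [Nat.cast_succ, ← Cardinal.succ_aleph] at h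
  exact Order.lt_succ_iff.1 h

theorem aleph_lt_aleph_succ (s : ℕ) :
    Cardinal.aleph (s : Ordinal.{u}) < Cardinal.aleph ((s + 1 : ℕ) : Ordinal.{u}) :=
  Cardinal.aleph_lt_aleph.2 (Nat.cast_lt.2 (Nat.lt_succ_self s))

theorem mk_index (P : DiagonalPairing B V W) {t : ℕ} (h : Module.rank ℂ V = Cardinal.aleph (t : Ordinal)) :
    Cardinal.mk B = Cardinal.aleph (t : Ordinal.{u}) := by
  have := P.basisV.mk_eq_rank
  rw [h] at this
  rw [← Cardinal.lift_inj, this]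
  simp

/-- An element of `gl^M_{s+1}` lives on the set `T` of its nonzero columns and of the rows they
meet, which has at most `ℵ_s` elements; `IsEndIdeal.containsBlock` supplies the block on `T`. -/
theorem glMs_succ_le {I : LieIdeal ℂ (glM P.form)} {s : ℕ}
    (h : ¬ I ≤ scalars P.form ⊔ glMs P s) : glMs P (s + 1) ≤ I := by
  obtain ⟨x, hx, hxs⟩ := SetLike.not_le_iff_exists.1 h
  rw [mem_scalars_sup_glMs_iff] at hxs
  push Not at hxs
  intro y hy
  rw [mem_glMs_iff] at hy
  replace hy := mk_le_aleph_of_lt hy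
  set S : Set B := {b : B | (y : Module.End ℂ V) (P.basisV b) ≠ 0}
  have haleph := Cardinal.aleph0_le_aleph (s : Ordinal.{u})
  set T : Set B := S ∪ ⋃ b : S, {a | entry P y a b ≠ 0} with hTdef
  have hT : Cardinal.mk T ≤ Cardinal.aleph (s : Ordinal.{u}) := by
    refine (Cardinal.mk_union_le _ _).trans (Cardinal.add_le_of_le haleph hy ?_)
    refine (Cardinal.mk_iUnion_le _).trans ((mul_le_mul' hy (ciSup_le' fun b => ?_)).trans
      (Cardinal.mul_eq_self haleph).le)
    exact (Cardinal.lt_aleph0_iff_set_finite.2 (finite_column P y b)).le.trans haleph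
  have hblock := (isEndIdeal_endIdeal P I).containsBlock ((coe_mem_endIdeal P).2 hx) haleph hxs hT
    y y.2
  rw [← coe_mem_endIdeal]
  convert hblock using 1
  refine entry_ext P fun a b => ?_
  rw [entry_mul_proj, entry_proj_mul]
  by_cases hab : entry P y a b = 0
  · simp [hab]
  · have hb : b ∈ S := fun hcon => hab (by simp [entry, hcon])
    have ha : a ∈ T := Or.inr (Set.mem_iUnion.2 ⟨⟨b, hb⟩, hab⟩)
    simp [ha, show b ∈ T from Or.inl hb]

/-- The witness is the projection onto one half of a set of size `ℵ_s`. It differs from the scalar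
`1` on the other half, and from every other scalar on its own half. -/
theorem glMs_succ_not_le {s : ℕ} (hs : Cardinal.aleph (s : Ordinal.{u}) ≤ Cardinal.mk B) :
    ¬ glMs P (s + 1) ≤ scalars P.form ⊔ glMs P s := by
  have haleph := Cardinal.aleph0_le_aleph (s : Ordinal.{u})
  obtain ⟨T, hT⟩ := Cardinal.le_mk_iff_exists_set.1 hs
  have hinf : T.Infinite := by
    rw [← Set.infinite_coe_iff, Cardinal.infinite_iff, hT]; exact haleph
  obtain ⟨A₁, A₂, hunion, hdisj, hcard⟩ := hinf.exists_union_disjoint_cardinal_eq_of_infinite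
  have hA₁ : Cardinal.aleph (s : Ordinal.{u}) ≤ Cardinal.mk A₁ := by
    by_contra! hlt
    rw [← hunion] at hT
    exact hT.ge.not_gt ((Cardinal.mk_union_le _ _).trans_lt
      (Cardinal.add_lt_of_lt haleph hlt (hcard ▸ hlt)))
  have hA₁' : Cardinal.mk A₁ ≤ Cardinal.aleph (s : Ordinal.{u}) := by
    rw [← hT, ← hunion]; exact Cardinal.mk_le_mk_of_subset Set.subset_union_left
  intro hle
  have hmem : (⟨proj P A₁, proj_mem P A₁⟩ : glM P.form) ∈ glMs P (s + 1) := by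
    rw [mem_glMs_iff]
    refine lt_of_le_of_lt (Cardinal.mk_le_mk_of_subset fun b hb => ?_)
      (hA₁'.trans_lt (aleph_lt_aleph_succ s))
    by_contra hcon
    exact hb (proj_basis_of_notMem P hcon)
  obtain ⟨c, hc⟩ := (mem_scalars_sup_glMs_iff P).1 (hle hmem)
  have hbasis : ∀ b, P.basisV b ≠ 0 := P.basisV.ne_zero
  by_cases hc1 : c = 1
  · refine hc.not_ge ((hcard ▸ hA₁ : _ ≤ Cardinal.mk A₂).trans
      (Cardinal.mk_le_mk_of_subset fun b hb => ?_))
    change proj P A₁ (P.basisV b) ≠ c • P.basisV b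
    rw [proj_basis_of_notMem P (Set.disjoint_right.1 hdisj hb), hc1, one_smul]
    exact (hbasis b).symm
  · refine hc.not_ge (hA₁.trans (Cardinal.mk_le_mk_of_subset fun b hb hcon => hc1 ?_))
    change proj P A₁ (P.basisV b) = c • P.basisV b at hcon
    rw [proj_basis_of_mem P hb] at hcon
    exact (smul_left_injective ℂ (hbasis b) (by simpa using hcon)).symm

theorem scalars_inf_glMs {s : ℕ} (hs : Cardinal.aleph (s : Ordinal.{u}) ≤ Cardinal.mk B) :
    scalars P.form ⊓ glMs P s = ⊥ := by
  rw [LieSubmodule.eq_bot_iff]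
  intro x hx
  obtain ⟨⟨c, hc⟩, hxs⟩ := (LieSubmodule.mem_inf _ _ _).1 hx
  rw [mem_glMs_iff] at hxs
  by_cases h0 : c = 0
  · exact Subtype.ext (by simp [hc, h0])
  · refine absurd hxs (not_lt_of_ge (hs.trans ?_))
    rw [← Cardinal.mk_univ]
    exact Cardinal.mk_le_mk_of_subset fun b _ => by simp [hc, h0, P.basisV.ne_zero b]

theorem isAtom_scalars [Nonempty B] : IsAtom (scalars P.form) := by
  have hid : LinearMap.id ∈ glM P.form := by
    rintro _ ⟨f, hf, rfl⟩
    exact hf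
  constructor
  · intro h
    have hmem : (⟨LinearMap.id, hid⟩ : glM P.form) ∈ scalars P.form := ⟨1, by simp⟩
    rw [h, LieSubmodule.mem_bot] at hmem
    obtain ⟨b⟩ := ‹Nonempty B›
    exact P.basisV.ne_zero b (LinearMap.congr_fun (congrArg Subtype.val hmem) (P.basisV b))
  · intro I hI
    rw [LieSubmodule.eq_bot_iff]
    by_contra! hcon
    obtain ⟨x, hx, hx0⟩ := hcon
    obtain ⟨c, hc⟩ := hI.le hx
    have hc0 : c ≠ 0 := fun h => hx0 (Subtype.ext (by simp [hc, h]))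
    refine hI.not_ge fun y ⟨d, hd⟩ => ?_
    have : y = (d * c⁻¹) • x := Subtype.ext (by simp [hc, hd, smul_smul, hc0])
    rw [this]
    exact I.smul_mem _ hx

/-! ## Operators of finite rank -/

/-- The elementary matrix `E_{ab}`. -/
noncomputable def elem (a b : B) : Module.End ℂ V :=
  tensorToEnd P.form (P.basisV a ⊗ₜ P.basisW b)

theorem elem_apply (a b : B) (v : V) : elem P a b v = P.basisV.repr v b • P.basisV a := by
  simp [elem, tensorToEnd, form_basis]

theorem entry_elem (a b i k : B) : entry P (elem P a b) i k =
    (Finsupp.single k (1 : ℂ) b) * (Finsupp.single a (1 : ℂ) i) := by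
  rw [entry, elem_apply, map_smul, P.basisV.repr_self, P.basisV.repr_self, Finsupp.smul_apply,
    smul_eq_mul]

theorem elem_mem (a b : B) : elem P a b ∈ glM P.form := by
  classical
  rw [mem_glM_iff]
  refine fun i => (Set.finite_singleton b).subset fun k hk => ?_
  rw [Set.mem_ofPred_eq, entry_elem] at hk
  by_contra hcon
  exact hk (by simp [Finsupp.single_apply, show k ≠ b from hcon])

theorem elem_mul_elem (a b c : B) : elem P a b * elem P b c = elem P a c := by
  ext v
  simp [elem_apply]

theorem lift_basis (a b : B) : TensorProduct.lift P.form (P.basisV a ⊗ₜ P.basisW b) =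
    Finsupp.single a (1 : ℂ) b := by
  simp [form_basis]

/-- The trace of a finite rank operator is the value of the pairing. -/
theorem trace_tensorToEnd (z : V ⊗[ℂ] W) :
    (fun b => entry P (tensorToEnd P.form z) b b).support.Finite ∧
      ∑ᶠ b, entry P (tensorToEnd P.form z) b b = TensorProduct.lift P.form z := by
  induction z with
  | zero => simp [entry]
  | add x y hx hy =>
    have h : (fun b => entry P (tensorToEnd P.form (x + y)) b b) = fun b =>
        entry P (tensorToEnd P.form x) b b + entry P (tensorToEnd P.form y) b b := by
      funext b
      rw [map_add, entry_add]
    rw [h, map_add, ← hx.2, ← hy.2]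
    exact ⟨(hx.1.union hy.1).subset (Function.support_add _ _), finsum_add_distrib hx.1 hy.1⟩
  | tmul v w =>
    have h : (fun b => entry P (tensorToEnd P.form (v ⊗ₜ w)) b b) = fun b =>
        P.basisV.repr v b * P.basisW.repr w b := by
      funext b
      simp [entry, tensorToEnd, basis_form, mul_comm]
    have hsub : (fun b => P.basisV.repr v b * P.basisW.repr w b).support ⊆
        ((P.basisV.repr v).support : Set B) := by
      intro b hb
      simp only [Function.mem_support] at hb
      simpa using left_ne_zero_of_mul hb
    rw [h]
    refine ⟨(Finset.finite_toSet _).subset hsub, ?_⟩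
    rw [finsum_eq_sum_of_support_subset _ hsub, TensorProduct.lift.tmul, P.form_eq]
    rfl

/-- The trace recovers the pairing from the operator, so it does not depend on the tensor chosen to
represent it. -/
theorem elem_notMem_slFin (a : B) : (⟨elem P a a, elem_mem P a a⟩ : glM P.form) ∉ slFin P.form := by
  classical
  rintro ⟨z, hz, hza⟩
  have h1 := (trace_tensorToEnd P z).2
  have h2 := (trace_tensorToEnd P (P.basisV a ⊗ₜ P.basisW a)).2
  have h3 : tensorToEnd P.form z = tensorToEnd P.form (P.basisV a ⊗ₜ P.basisW a) := hza
  rw [h3, h2, lift_basis, Finsupp.single_eq_same] at h1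
  exact one_ne_zero (h1.trans hz)

theorem elem_mem_glFin (a b : B) : (⟨elem P a b, elem_mem P a b⟩ : glM P.form) ∈ glFin P.form :=
  ⟨P.basisV a ⊗ₜ P.basisW b, rfl⟩

theorem exists_sub_smul_elem_mem_slFin (a : B) {x : glM P.form} (hx : x ∈ glFin P.form) :
    ∃ c : ℂ, x - c • ⟨elem P a a, elem_mem P a a⟩ ∈ slFin P.form := by
  obtain ⟨z, hz⟩ := hx
  refine ⟨TensorProduct.lift P.form z,
    z - TensorProduct.lift P.form z • (P.basisV a ⊗ₜ P.basisW a), ?_, ?_⟩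
  · change TensorProduct.lift P.form (_ - _) = 0
    rw [map_sub, map_smul, lift_basis]
    simp
  · rw [map_sub, map_smul, hz]
    rfl

theorem slFin_le_glFin : slFin P.form ≤ glFin P.form := by
  rintro x ⟨z, -, hz⟩
  exact ⟨z, hz⟩

theorem lie_mem_slFin (y : glM P.form) {x : glM P.form} (hx : x ∈ glFin P.form) :
    ⁅y, x⁆ ∈ slFin P.form := by
  obtain ⟨z, hz⟩ := hx
  obtain ⟨z', h0, hz'⟩ := exists_lie_tensorToEnd y z
  exact ⟨z', h0, by rw [hz', hz]; rfl⟩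

theorem slFin_covBy_glFin [Nonempty B] : slFin P.form ⋖ glFin P.form := by
  obtain ⟨a⟩ := ‹Nonempty B›
  refine ⟨lt_of_le_of_ne (slFin_le_glFin P) fun h => elem_notMem_slFin P a
    (h ▸ elem_mem_glFin P a a), fun I h1 h2 => h2.not_ge ?_⟩
  obtain ⟨x, hx, hxs⟩ := SetLike.exists_of_lt h1
  obtain ⟨c, hc⟩ := exists_sub_smul_elem_mem_slFin P a (h2.le hx)
  have hc0 : c ≠ 0 := by
    rintro rfl
    exact hxs (by simpa using hc)
  have helem : (⟨elem P a a, elem_mem P a a⟩ : glM P.form) ∈ I := by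
    have := I.smul_mem c⁻¹ (sub_mem hx (h1.le hc))
    rwa [sub_sub_cancel, smul_smul, inv_mul_cancel₀ hc0, one_smul] at this
  intro y hy
  obtain ⟨d, hd⟩ := exists_sub_smul_elem_mem_slFin P a hy
  simpa using add_mem (h1.le hd) (I.smul_mem d helem)

theorem slFin_ne_bot [Nontrivial B] : slFin P.form ≠ ⊥ := by
  classical
  obtain ⟨a, b, hab⟩ := exists_pair_ne B
  intro h
  have hmem : (⟨elem P a b, elem_mem P a b⟩ : glM P.form) ∈ slFin P.form :=
    by
    refine ⟨P.basisV a ⊗ₜ P.basisW b, ?_, rfl⟩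
    change TensorProduct.lift P.form (P.basisV a ⊗ₜ P.basisW b) = 0
    rw [lift_basis, Finsupp.single_eq_of_ne hab.symm]
  rw [h, LieSubmodule.mem_bot] at hmem
  have := LinearMap.congr_fun (congrArg Subtype.val hmem) (P.basisV b)
  simp [elem_apply, P.basisV.ne_zero a] at this

theorem glMs_zero : glMs P 0 = glFin P.form := by
  classical
  apply le_antisymm
  · intro x hx
    rw [mem_glMs_iff, Nat.cast_zero, Cardinal.aleph_zero, Cardinal.lt_aleph0_iff_set_finite] at hx
    -- An operator with finitely many nonzero columns is the sum of its columns, each a rank-one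
    -- tensor with `w_b`.
    refine ⟨∑ b ∈ hx.toFinset, (x : Module.End ℂ V) (P.basisV b) ⊗ₜ P.basisW b, ?_⟩
    refine P.basisV.ext fun b => ?_
    rw [map_sum, LinearMap.sum_apply]
    by_cases hb : (x : Module.End ℂ V) (P.basisV b) = 0
    · rw [Finset.sum_eq_zero]
      · exact hb.symm
      · intro k hk
        have hkb : k ≠ b := by
          rintro rfl
          exact hx.mem_toFinset.1 hk hb
        simp [tensorToEnd, form_basis, hkb.symm]
    · rw [Finset.sum_eq_single b]
      · simp [tensorToEnd, form_basis]
      · intro k _ hkb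
        simp [tensorToEnd, form_basis, hkb.symm]
      · intro hcon
        exact absurd (hx.mem_toFinset.2 hb) hcon
  · rintro x ⟨z, hz⟩
    have hz' : tensorToEnd P.form z = (x : Module.End ℂ V) := hz
    rw [mem_glMs_iff, Nat.cast_zero, Cardinal.aleph_zero, Cardinal.lt_aleph0_iff_set_finite, ← hz']
    clear hz hz' x
    induction z with
    | zero => simp
    | add x y hx hy =>
      refine (hx.union hy).subset fun b hb => ?_
      by_contra hcon
      simp only [Set.mem_union, Set.mem_ofPred_eq, not_or, not_not] at hcon
      exact hb (by simp [hcon.1, hcon.2])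
    | tmul v w =>
      refine (P.basisW.repr w).hasFiniteSupport.subset fun b hb hcon => hb ?_
      simp [tensorToEnd, basis_form, hcon]

theorem slFin_le [Infinite B] {I : LieIdeal ℂ (glM P.form)} (h : ¬ I ≤ scalars P.form) :
    slFin P.form ≤ I := by
  classical
  obtain ⟨x, hx, hxs⟩ := SetLike.not_le_iff_exists.1 h
  have hns : ∀ c : ℂ, (x : Module.End ℂ V) ≠ c • LinearMap.id := fun c hc => hxs ⟨c, hc⟩
  have hI := isEndIdeal_endIdeal P I
  have hoff : ∀ a b, a ≠ b → elem P a b ∈ endIdeal P I := by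
    intro a b hab
    have := hI.containsBlock_singleton ((coe_mem_endIdeal P).2 hx) hns hab _ (elem_mem P a b)
    convert this using 1
    refine entry_ext P fun i k => ?_
    rw [entry_mul_proj, entry_proj_mul, entry_elem]
    by_cases hi : i = a <;> by_cases hk : k = b <;> simp [hi, hk]
  obtain ⟨o⟩ := (inferInstance : Nonempty B)
  have hdiag : ∀ a, elem P a a - elem P o o ∈ endIdeal P I := by
    intro a
    by_cases ha : a = o
    · simp [ha]
    · have := hI.comm _ (hoff a o ha) _ (elem_mem P o a)
      rwa [elem_mul_elem, elem_mul_elem] at this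
  -- Modulo `I`, every tensor `z` acts as `p(z) E_oo`, by a check on basis tensors; if `p(z) = 0`,
  -- its operator lies in `I`.
  have hzero : (endIdeal P I).mkQ ∘ₗ (tensorToEnd P.form -
      (TensorProduct.lift P.form).smulRight (elem P o o)) = 0 := by
    refine TensorProduct.ext (P.basisV.ext fun a => P.basisW.ext fun b => ?_)
    change (endIdeal P I).mkQ (elem P a b -
      TensorProduct.lift P.form (P.basisV a ⊗ₜ P.basisW b) • elem P o o) = 0
    rw [Submodule.mkQ_apply, Submodule.Quotient.mk_eq_zero, lift_basis]
    by_cases hab : a = b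
    · subst hab
      simpa using hdiag a
    · simpa [Finsupp.single_apply, hab] using hoff a b hab
  rintro y ⟨z, hz0, hz⟩
  have hz' : tensorToEnd P.form z = (y : Module.End ℂ V) := hz
  have hz0' : TensorProduct.lift P.form z = 0 := hz0
  have := LinearMap.congr_fun hzero z
  rw [LinearMap.comp_apply, LinearMap.zero_apply, Submodule.mkQ_apply,
    Submodule.Quotient.mk_eq_zero, LinearMap.sub_apply, LinearMap.smulRight_apply, hz0', zero_smul,
    sub_zero, hz', coe_mem_endIdeal] at this
  exact this

/-- The ideals `ℂ id`, `sl` and `gl^M_s` of the Mackey Lie algebra. -/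
theorem idealChain {t : ℕ} (h : Module.rank ℂ V = Cardinal.aleph (t : Ordinal)) :
    IdealChain t (scalars P.form) (slFin P.form) (glMs P) := by
  have hB := mk_index P h
  have hle : ∀ s ≤ t, Cardinal.aleph (s : Ordinal.{u}) ≤ Cardinal.mk B := fun s hs => by
    rw [hB]; exact Cardinal.aleph_le_aleph.2 (Nat.cast_le.2 hs)
  have : Infinite B := by
    rw [Cardinal.infinite_iff, hB]; exact Cardinal.aleph0_le_aleph _
  exact {
    atom := isAtom_scalars P
    ne_bot := slFin_ne_bot P
    mono := glMs_mono P
    eq_top := by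
      rw [eq_top_iff]
      intro x _
      rw [mem_glMs_iff]
      refine (Cardinal.mk_set_le _).trans_lt ?_
      rw [hB]
      exact aleph_lt_aleph_succ t
    inf_eq := scalars_inf_glMs P (hle t le_rfl)
    covBy := by
      rw [glMs_zero]
      exact slFin_covBy_glFin P
    le_of_not_le := fun I hI => slFin_le P hI
    succ_le_of_not_le := fun s _ I hI => glMs_succ_le P hI
    not_succ_le := fun s hs => glMs_succ_not_le P (hle s hs) }

/-- The quotient of `ℂ id ⊕ gl` by `ℂ id ⊕ sl` is the trivial module of dimension one. -/
theorem finrank_subquotient_eq_one {N D : LieIdeal ℂ (glM P.form)}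
    (hN : N = scalars P.form ⊔ glFin P.form) (hD : D = scalars P.form ⊔ slFin P.form)
    (hlt : D < N) :
    Module.finrank ℂ (LieRep.Subquotient N D) = 1 ∧
      LieModule.IsTrivial (glM P.form) (LieRep.Subquotient N D) := by
  constructor
  · have hne : Nonempty B := by
      by_contra hcon
      rw [not_nonempty_iff] at hcon
      refine hlt.not_ge fun x _ => ?_
      rw [show x = 0 from Subtype.ext (P.basisV.ext fun b => hcon.elim b)]
      exact zero_mem D
    obtain ⟨a⟩ := hne
    set g : glM P.form := ⟨elem P a a, elem_mem P a a⟩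
    have hgN : g ∈ N := hN ▸ LieSubmodule.mem_sup_right (elem_mem_glFin P a a)
    have key : ∀ x ∈ N, ∃ c : ℂ, x - c • g ∈ D := by
      intro x hx
      rw [hN] at hx
      obtain ⟨y, hy, z, hz, rfl⟩ := (LieSubmodule.mem_sup _ _ _).1 hx
      obtain ⟨c, hc⟩ := exists_sub_smul_elem_mem_slFin P a hz
      refine ⟨c, ?_⟩
      rw [hD, add_sub_assoc]
      exact add_mem (LieSubmodule.mem_sup_left hy) (LieSubmodule.mem_sup_right hc)
    -- If `E_aa` were in `D`, then `key` would give `N ≤ D`; so its class is a nonzero generator.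
    have hgD : g ∉ D := by
      intro hg
      refine hlt.not_ge fun x hx => ?_
      obtain ⟨c, hc⟩ := key x hx
      simpa using add_mem hc (D.smul_mem c hg)
    let v : LieRep.Subquotient N D := LieSubmodule.Quotient.mk (⟨g, hgN⟩ : N)
    have hv : v ≠ 0 := fun h0 => hgD ((LieSubmodule.Quotient.mk_eq_zero (D.comap N.incl)).1 h0)
    refine (finrank_eq_one_iff_of_nonzero' v hv).2 fun w => ?_
    obtain ⟨⟨x, hx⟩, rfl⟩ := LieSubmodule.Quotient.surjective_mk' _ w
    obtain ⟨c, hc⟩ := key x hx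
    refine ⟨c, ?_⟩
    symm
    exact (Submodule.Quotient.eq (D.comap N.incl).toSubmodule).2 hc
  · refine ⟨fun y m => ?_⟩
    obtain ⟨⟨x, hx⟩, rfl⟩ := LieSubmodule.Quotient.surjective_mk' _ m
    refine (LieSubmodule.Quotient.mk_eq_zero (D.comap N.incl)
      (m := ⁅y, (⟨x, hx⟩ : N)⁆)).2 ?_
    change ⁅y, x⁆ ∈ D
    rw [hN] at hx
    obtain ⟨z, ⟨c, hc⟩, w, hw, rfl⟩ := (LieSubmodule.mem_sup _ _ _).1 hx
    have h0 : ⁅y, z⁆ = 0 := Subtype.ext (by ext u; simp [hc, Ring.lie_def])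
    rw [lie_add, h0, zero_add, hD]
    exact LieSubmodule.mem_sup_right (lie_mem_slFin P y hw)

end Mackey

/-! ### The adjoint module: assembly of the results -/

theorem mainTheorem9 {B V W : Type*} [AddCommGroup V] [Module ℂ V] [AddCommGroup W] [Module ℂ W]
    (P : DiagonalPairing B V W) (t : ℕ)
    (hdim : Module.rank ℂ V = Cardinal.aleph (t : Ordinal)) :
    -- The adjoint module is indecomposable, of length `t + 4`.
    LieRep.IsIndecomposable ℂ (Mackey.glM P.form) (Mackey.glM P.form) ∧
    LieRep.length ℂ (Mackey.glM P.form) (Mackey.glM P.form) = ((t + 4 : ℕ) : WithBot ℕ∞) ∧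
    -- The ends of the chain of ideals `gl^M_s`.
    Mackey.glMs P 0 = Mackey.glFin P.form ∧
    Mackey.glMs P (t + 1) = ⊤ ∧
    -- The socle filtration.
    LieRep.IsDirectSum (LieRep.soc ℂ (Mackey.glM P.form) (Mackey.glM P.form) 1)
      (Mackey.scalars P.form) (Mackey.slFin P.form) ∧
    LieRep.IsDirectSum (LieRep.soc ℂ (Mackey.glM P.form) (Mackey.glM P.form) 2)
      (Mackey.scalars P.form) (Mackey.glFin P.form) ∧
    (∀ s : ℕ, s < t →
      LieRep.IsDirectSum (LieRep.soc ℂ (Mackey.glM P.form) (Mackey.glM P.form) (s + 3))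
        (Mackey.scalars P.form) (Mackey.glMs P (s + 1))) ∧
    LieRep.soc ℂ (Mackey.glM P.form) (Mackey.glM P.form) (t + 3) = ⊤ ∧
    -- The layers of the socle filtration.
    LieRep.CanonicallyIso (Mackey.glFin P.form) (Mackey.slFin P.form)
      (LieRep.soc ℂ (Mackey.glM P.form) (Mackey.glM P.form) 2)
      (LieRep.soc ℂ (Mackey.glM P.form) (Mackey.glM P.form) 1) ∧
    Module.finrank ℂ (LieRep.Layer ℂ (Mackey.glM P.form) (Mackey.glM P.form) 2) = 1 ∧
    LieModule.IsTrivial (Mackey.glM P.form)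
      (LieRep.Layer ℂ (Mackey.glM P.form) (Mackey.glM P.form) 2) ∧
    (∀ s : ℕ, s < t →
      LieRep.CanonicallyIso (Mackey.glMs P (s + 1)) (Mackey.glMs P s)
        (LieRep.soc ℂ (Mackey.glM P.form) (Mackey.glM P.form) (s + 3))
        (LieRep.soc ℂ (Mackey.glM P.form) (Mackey.glM P.form) (s + 2))) ∧
    LieRep.CanonicallyIso (⊤ : LieIdeal ℂ (Mackey.glM P.form)) (Mackey.scalars P.form ⊔ Mackey.glMs P t)
      (LieRep.soc ℂ (Mackey.glM P.form) (Mackey.glM P.form) (t + 3))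
      (LieRep.soc ℂ (Mackey.glM P.form) (Mackey.glM P.form) (t + 2)) ∧
    (∀ s : ℕ, 1 ≤ s → s ≤ t + 2 →
      LieModule.IsIrreducible ℂ (Mackey.glM P.form)
        (LieRep.Layer ℂ (Mackey.glM P.form) (Mackey.glM P.form) (s + 1))) ∧
    -- The radical filtration.
    LieRep.IsDirectSum (LieRep.rad ℂ (Mackey.glM P.form) (Mackey.glM P.form) 1)
      (Mackey.scalars P.form) (Mackey.glMs P t) ∧
    (∀ s : ℕ, 1 ≤ s → s ≤ t →
      LieRep.rad ℂ (Mackey.glM P.form) (Mackey.glM P.form) (s + 1) = Mackey.glMs P (t - s)) ∧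
    LieRep.rad ℂ (Mackey.glM P.form) (Mackey.glM P.form) (t + 2) = Mackey.slFin P.form := by
  have h := Mackey.idealChain P hdim
  have hzero := Mackey.glMs_zero P
  obtain ⟨hsoc₁, hsoc⟩ := h.soc_eq (f := LieRep.soc ℂ (Mackey.glM P.form) (Mackey.glM P.form)) rfl
    LieRep.soc_succ
  obtain ⟨hrad₁, hrad, hradt⟩ := h.rad_eq
    (r := LieRep.rad ℂ (Mackey.glM P.form) (Mackey.glM P.form)) rfl LieRep.rad_succ
  have hsoc₂ : LieRep.soc ℂ (Mackey.glM P.form) (Mackey.glM P.form) 2 =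
      Mackey.scalars P.form ⊔ Mackey.glFin P.form := hzero ▸ hsoc 0 (Nat.zero_le _)
  have hsoct : LieRep.soc ℂ (Mackey.glM P.form) (Mackey.glM P.form) (t + 3) = ⊤ := by
    have := hsoc (t + 1) le_rfl
    rwa [h.eq_top, sup_top_eq] at this
  have hcov₁ : LieRep.soc ℂ (Mackey.glM P.form) (Mackey.glM P.form) 1 ⋖
      LieRep.soc ℂ (Mackey.glM P.form) (Mackey.glM P.form) 2 := by
    rw [hsoc₁, hsoc₂, ← hzero]
    exact h.sup_covBy_sup
  have hcov : ∀ s ≤ t, LieRep.soc ℂ (Mackey.glM P.form) (Mackey.glM P.form) (s + 2) ⋖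
      LieRep.soc ℂ (Mackey.glM P.form) (Mackey.glM P.form) (s + 3) := by
    intro s hs
    rw [hsoc s (by omega), hsoc (s + 1) (by omega)]
    exact h.sup_covBy_sup_succ hs
  have hlayer := Mackey.finrank_subquotient_eq_one P hsoc₂ hsoc₁ hcov₁.lt
  refine ⟨⟨?_, h.indecomposable⟩, h.krullDim_eq, hzero, h.eq_top,
    ⟨hsoc₁.symm, disjoint_iff.2 h.disjoint_bot⟩,
    ⟨hsoc₂.symm, disjoint_iff.2 (hzero ▸ h.disjoint (Nat.zero_le t))⟩,
    fun s hs => ⟨(hsoc (s + 1) (by omega)).symm, disjoint_iff.2 (h.disjoint hs)⟩, hsoct,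
    ?_, hlayer.1, hlayer.2, fun s hs => ?_, ?_, fun s hs hst => ?_,
    ⟨hrad₁.symm, disjoint_iff.2 h.inf_eq⟩, hrad, hradt⟩
  · refine (LieSubmodule.nontrivial_iff ℂ (Mackey.glM P.form) (Mackey.glM P.form)).1 ?_
    exact ⟨_, _, h.ne_bot⟩
  · refine LieRep.canonicallyIso_of_sup_eq (hsoc₁ ▸ le_sup_right) ?_ ?_
    · rw [hsoc₁, hsoc₂, sup_assoc, sup_eq_right.2 (Mackey.slFin_le_glFin P)]
    · rw [hsoc₁, ← hzero]
      exact (h.sup_inf (Nat.zero_le t) h.covBy.le).le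
  · have hle := h.mono (Nat.le_succ s)
    refine LieRep.canonicallyIso_of_sup_eq (hsoc s (by omega) ▸ le_sup_right) ?_ ?_
    · rw [hsoc s (by omega), hsoc (s + 1) (by omega), sup_assoc, sup_eq_right.2 hle]
    · rw [hsoc s (by omega)]
      exact (h.sup_inf hs hle).le
  · refine LieRep.canonicallyIso_of_sup_eq (hsoc t (by omega)).ge ?_ ?_
    · rw [hsoct, sup_top_eq]
    · rw [hsoc t (by omega), inf_top_eq]
  · refine LieRep.isIrreducible_subquotient ?_
    rw [Nat.add_sub_cancel]
    -- The second layer comes from `sl ⋖ gl`; the later ones come from `ℂ id ⊕ gl^M_u`, the last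
    -- being `u = t`.
    obtain rfl | ⟨u, rfl⟩ : s = 1 ∨ ∃ u, s = u + 2 := by
      rcases Nat.lt_or_ge s 2 with h2 | h2
      · exact Or.inl (by omega)
      · exact Or.inr ⟨s - 2, by omega⟩
    · exact hcov₁
    · exact hcov u (by omega)
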